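/- **Theorem 2.1.** Let $V$ be an arbitrary real potential and let $H$ be the discrete Schrödinger operator $(H\psi)(n)=\psi(n+1)+\psi(n-1)+V(n)\psi(n)$ in $\ell^2(\mathbb Z)$, or in $\ell^2(\mathbb N)$, $\mathbb N=\{1,2,\dots\}$, with Dirichlet condition $\psi(0)=0$, self-adjoint on its maximal domain $\{\psi\in\ell^2: H\psi\in\ell^2\}$. Let $\mu$ be the spectral measure of $H$ and $\delta_1$, $F(z)=\int_{\mathbb R}\frac{d\mu(x)}{x-z}$, and $$a(n,T)=\frac1T\int_0^\infty e^{-2t/T}|\langle\delta_n,e^{-itH}\delta_1\rangle|^2dt,\qquad \langle|X|^p\rangle(T)=\sum_n|n|^pa(n,T),\qquad \beta^-(p)=\liminf_{T\to\infty}\frac{\log\langle|X|^p\rangle(T)}{\log T}.$$ For $E\in\mathbb R$ let $T(n,m;E)$ be the transfer matrix, i.e. $(\phi(n+1),\phi(n))^T=T(n,m;E)(\phi(m+1),\phi(m))^T$ for every solution of $\phi(k+1)+\phi(k-1)+V(k)\phi(k)=E\phi(k)$, and let $\|\cdot\|$ be the operator norm. Below $n,m$ range over $\mathbb Z$ in the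 whole-line case and over $\mathbb N$ in the half-line case. $|B|$ is the Lebesgue measure of $B$. (a) Let $K,C,\alpha>0$ and suppose that for every sufficiently large real $N$ a nonempty Borel set $A(N)\subset[-K,K]$ is given with $$\|T(n,m;E)\|\le CN^\alpha\quad\text{for all }E\in A(N)\text{ and all }n,m\text{ with }|n|\le N,\ |m|\le N.$$ Put $N(T)=T^{1/(1+\alpha)}$, $B_j(T)=\{E\in\mathbb R:\exists E'\in A(N(T)),\ |E-E'|\le j/T\}$ for $j=1,2$, and $P(T)=\sum_{|n|\ge N(T)/2}a(n,T)$. Then there is $c>0$ such that for all sufficiently large $T$ $$P(T)\ge\frac cT N(T)^{1-2\alpha}\int_{B_2(T)}\Bigl(1+\bigl(\operatorname{Im}F(E+i/T)\bigr)^2\Bigr)dE ,$$ there is $c>0$ such that for all sufficiently large $T$ $$P(T)\ge\frac cT N(T)^{1-2\alpha}\bigl(|B_1(T)|+\mu(B_1(T))\bigr),$$ and for every $p>0$ there is $c>0$ such that for all sufficiently large $T$ $$\langle|X|^p\rangle(T)\ge\frac cT N(T)^{p+1-2\alpha}\bigl(|B_1(T)|+\mu(B_1(T))\bigr).$$ (b)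 Let $K>0$, $\alpha\ge0$, and let $A\subset[-K,K]$ be a Borel set with $\mu(A)>0$ such that for some constant $C$, $\|T(n,m;E)\|\le C(|n|^\alpha+|m|^\alpha)$ for all $E\in A$ and all $(n,m)\ne(0,0)$. Then $\beta^-(p)\ge\dfrac{p-3\alpha}{1+\alpha}$ for every $p>0$. (c) Let $\alpha\ge0$ and $E_0\in\mathbb R$, and suppose that for some constant $C$, $\|T(n,m;E_0)\|\le C(|n|^\alpha+|m|^\alpha)$ for all $(n,m)\ne(0,0)$. Then for every $p>0$ there is $c>0$ such that for all sufficiently large $T$ $$\langle|X|^p\rangle(T)\ge c\,T^{\frac{p-3\alpha}{1+\alpha}}\Bigl(T^{-1}+\mu\bigl([E_0-T^{-1},E_0+T^{-1}]\bigr)\Bigr).$$ Suppose moreover that $E_0$ is an eigenvalue: $H\psi=E_0\psi$ for some $\psi\in\ell^2$, $\psi\ne0$. Then $\alpha>1/2$; in the half-line case $\psi(1)\ne0$; and if $\psi(1)\ne0$, then $\beta^-(p)\ge\dfrac{p+1-2\alpha}{1+\alpha}$ for every $p>0$. -/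

import Mathlib

open MeasureTheory Filter Topology
open scoped ENNReal Matrix.Norms.L2Operator

noncomputable section

namespace Schrodinger

variable {Λ : Set ℤ}

/-! ### The operator -/

/-- The Hilbert space `ℓ²(Λ)`; `Λ = ℤ` for the whole line and `Λ = {1, 2, …}` for the half-line. -/
abbrev Ell2 (Λ : Set ℤ) : Type := lp (fun _ : Λ => ℂ) 2

/-- Extension of a sequence on `Λ` to `ℤ` by zero. On the half-line this is the Dirichlet condition
`f 0 = 0`. -/
def extendZero (f : Λ → ℂ) : ℤ → ℂ := Function.extend Subtype.val f 0

/-- The difference expression `f (n + 1) + f (n - 1) + V n * f n` for `n ∈ Λ`, for an arbitrary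
sequence `f` on `Λ`. On the half-line the values of `V` outside `Λ` play no role. -/
def action (V : ℤ → ℝ) (f : Λ → ℂ) (n : Λ) : ℂ :=
  extendZero f ((n : ℤ) + 1) + extendZero f ((n : ℤ) - 1) + (V n : ℂ) * f n

theorem extendZero_add (f g : Λ → ℂ) (n : ℤ) :
    extendZero (f + g) n = extendZero f n + extendZero g n := by
  by_cases h : ∃ a : Λ, (a : ℤ) = n
  · obtain ⟨a, rfl⟩ := h
    simp [extendZero]
  · simp [extendZero, Function.extend_apply' _ _ _ h]

theorem extendZero_smul (c : ℂ) (f : Λ → ℂ) (n : ℤ) :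
    extendZero (c • f) n = c * extendZero f n := by
  by_cases h : ∃ a : Λ, (a : ℤ) = n
  · obtain ⟨a, rfl⟩ := h
    simp [extendZero]
  · simp [extendZero, Function.extend_apply' _ _ _ h]

theorem action_add (V : ℤ → ℝ) (f g : Λ → ℂ) : action V (f + g) = action V f + action V g := by
  funext n
  simp only [action, extendZero_add, Pi.add_apply]
  ring

theorem action_smul (V : ℤ → ℝ) (c : ℂ) (f : Λ → ℂ) : action V (c • f) = c • action V f := by
  funext n
  simp only [action, extendZero_smul, Pi.smul_apply, smul_eq_mul]
  ring

/-- The self-adjoint Schrödinger operator `H` in `ℓ²(Λ)` with a possibly unbounded potential: it acts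
by `action V` on the maximal domain `{f ∈ ℓ² | H f ∈ ℓ²}`. For bounded `V` the domain is `ℓ²(Λ)`. -/
def hamiltonian (Λ : Set ℤ) (V : ℤ → ℝ) : Ell2 Λ →ₗ.[ℂ] Ell2 Λ where
  domain :=
    { carrier := {f | Memℓp (action V (f : Λ → ℂ)) 2}
      add_mem' := fun {f g} hf hg => by
        have h := Memℓp.add hf hg
        rw [Set.mem_ofPred_eq, lp.coeFn_add]
        rw [← action_add] at h
        exact h
      zero_mem' := by
        have : action V ((0 : Ell2 Λ) : Λ → ℂ) = 0 := by
          have := action_smul V 0 ((0 : Ell2 Λ) : Λ → ℂ)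
          rw [zero_smul, zero_smul] at this
          exact this
        rw [Set.mem_ofPred_eq, this]
        exact zero_memℓp
      smul_mem' := fun c f hf => by
        have h := Memℓp.const_smul hf c
        rw [Set.mem_ofPred_eq, lp.coeFn_smul]
        rw [← action_smul] at h
        exact h }
  toFun :=
    { toFun := fun f => ⟨action V (f : Ell2 Λ), f.2⟩
      map_add' := fun f g => lp.ext (action_add V (f : Ell2 Λ) (g : Ell2 Λ))
      map_smul' := fun c f => lp.ext (action_smul V c (f : Ell2 Λ)) }

/-- The unit vector `δ_k` of `ℓ²(Λ)` (zero by convention when `k ∉ Λ`). -/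
def delta (Λ : Set ℤ) (k : ℤ) : Ell2 Λ :=
  open Classical in if h : k ∈ Λ then lp.single 2 ⟨k, h⟩ 1 else 0

/-! ### Linear ordinary differential equations -/

theorem continuous_apply_of_bdd {E : Type*} [NormedAddCommGroup E] [NormedSpace ℝ E]
    (B : ℝ → E →L[ℝ] E) (C : ℝ) (hB : ∀ t, ‖B t‖ ≤ C) (hc : ∀ x, Continuous fun t => B t x)
    {w : ℝ → E} (hw : Continuous w) : Continuous fun t => B t (w t) := by
  rw [continuous_iff_continuousAt]
  intro s
  rw [ContinuousAt, tendsto_iff_norm_sub_tendsto_zero]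
  have h1 : Tendsto (fun t => C * ‖w t - w s‖ + ‖B t (w s) - B s (w s)‖) (𝓝 s) (𝓝 0) := by
    have a := (tendsto_iff_norm_sub_tendsto_zero.1 (hw.tendsto s)).const_mul C
    have b := tendsto_iff_norm_sub_tendsto_zero.1 ((hc (w s)).tendsto s)
    simpa using a.add b
  refine squeeze_zero (fun _ => norm_nonneg _) (fun t => ?_) h1
  have : B t (w t) - B s (w s) = B t (w t - w s) + (B t (w s) - B s (w s)) := by
    rw [map_sub]; abel
  rw [this]
  exact (norm_add_le _ _).trans (add_le_add_left ((B t).le_of_opNorm_le (hB t) _) _)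

theorem exists_linear_ode {E : Type*} [NormedAddCommGroup E] [NormedSpace ℝ E] [CompleteSpace E]
    (B : ℝ → E →L[ℝ] E) (C : ℝ) (hB : ∀ t, ‖B t‖ ≤ C) (hc : ∀ x, Continuous fun t => B t x)
    (x : E) : ∃ w : ℝ → E, w 0 = x ∧ ∀ t, HasDerivAt w (B t (w t)) t := by
  have hC : 0 ≤ C := (norm_nonneg _).trans (hB 0)
  obtain ⟨w, w0, wS⟩ : ∃ w : ℕ → ℝ → E, (∀ t, w 0 t = x) ∧
      ∀ k t, w (k + 1) t = ∫ s in (0 : ℝ)..t, B s (w k s) :=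
    ⟨fun k => Nat.rec (fun _ => x) (fun _ v t => ∫ s in (0 : ℝ)..t, B s (v s)) k,
      fun _ => rfl, fun _ _ => rfl⟩
  have hcont : ∀ k, Continuous (w k) := by
    intro k
    induction k with
    | zero => simpa only [funext w0] using continuous_const
    | succ k ih =>
      rw [funext (wS k)]
      exact intervalIntegral.continuous_primitive
        (fun a b => (continuous_apply_of_bdd B C hB hc ih).intervalIntegrable a b) 0
  have hder : ∀ k t, HasDerivAt (w (k + 1)) (B t (w k t)) t := fun k t => by
    rw [funext (wS k)]
    exact intervalIntegral.integral_hasDerivAt_right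
      ((continuous_apply_of_bdd B C hB hc (hcont k)).intervalIntegrable _ _)
      ((continuous_apply_of_bdd B C hB hc (hcont k)).stronglyMeasurableAtFilter _ _)
      (continuous_apply_of_bdd B C hB hc (hcont k)).continuousAt
  have hbd : ∀ k t, ‖w k t‖ ≤ (C * |t|) ^ k / k.factorial * ‖x‖ := by
    intro k
    induction k with
    | zero => intro t; simp [w0]
    | succ k ih =>
      intro t
      rw [wS]
      refine intervalIntegral.norm_integral_le_integral_norm_uIoc.trans ?_
      have hint : IntegrableOn (fun s : ℝ => C ^ (k + 1) / k.factorial * ‖x‖ * |s - 0| ^ k)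
          (Set.uIoc 0 t) := by
        have : Continuous (fun s : ℝ => C ^ (k + 1) / k.factorial * ‖x‖ * |s - 0| ^ k) := by
          fun_prop
        exact (this.intervalIntegrable 0 t).def'
      refine (setIntegral_mono_on ?_ hint measurableSet_uIoc (fun s _ => ?_)).trans (le_of_eq ?_)
      · exact ((continuous_apply_of_bdd B C hB hc (hcont k)).norm.intervalIntegrable 0 t).def'
      · refine ((B s).le_of_opNorm_le (hB s) _).trans
          ((mul_le_mul_of_nonneg_left (ih s) hC).trans (le_of_eq ?_))
        rw [sub_zero]; ring
      · rw [integral_const_mul, integral_pow_abs_sub_uIoc, sub_zero, Nat.factorial_succ]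
        push_cast
        field_simp
        rw [mul_pow]
        ring
  have hsum : ∀ t, Summable fun k => w k t := fun t =>
    Summable.of_norm_bounded ((Real.summable_pow_div_factorial (C * |t|)).mul_right ‖x‖)
      (fun k => hbd k t)
  refine ⟨fun t => ∑' k, w k t, ?_, fun t => ?_⟩
  · show ∑' k, w k 0 = x
    rw [tsum_eq_single 0, w0]
    intro k hk
    obtain ⟨j, rfl⟩ := Nat.exists_eq_succ_of_ne_zero hk
    simp [wS]
  · have e : (fun t => ∑' k, w k t) = fun t => x + ∑' k, w (k + 1) t := by
      funext t; rw [(hsum t).tsum_eq_zero_add, w0]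
    have e2 : B t (∑' k, w k t) = ∑' k, B t (w k t) := (B t).map_tsum (hsum t)
    simp only [e2]
    rw [e]
    refine HasDerivAt.const_add x ?_
    have hR : t ∈ Metric.ball (0 : ℝ) (|t| + 1) := by simp
    refine hasDerivAt_tsum_of_isPreconnected (t := Metric.ball (0 : ℝ) (|t| + 1))
      (u := fun k => C * ((C * (|t| + 1)) ^ k / k.factorial * ‖x‖)) ?_ Metric.isOpen_ball
      (convex_ball _ _).isPreconnected (fun k y _ => hder k y) (fun k y hy => ?_) hR
      ((summable_nat_add_iff 1).2 (hsum t)) hR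
    · exact ((Real.summable_pow_div_factorial _).mul_right ‖x‖).mul_left C
    · refine ((B y).le_of_opNorm_le (hB y) _).trans (mul_le_mul_of_nonneg_left ?_ hC)
      refine (hbd k y).trans ?_
      have : |y| ≤ |t| + 1 := by simpa using (Metric.mem_ball.1 hy).le
      gcongr

/-! ### Existence of the time evolution -/

theorem hasSum_sq (f : Ell2 Λ) : HasSum (fun n : ℤ => ‖extendZero f n‖ ^ 2) (‖f‖ ^ 2) := by
  have h := lp.hasSum_norm (p := 2) (by simp) f
  simp only [ENNReal.toReal_ofNat, Real.rpow_ofNat] at h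
  rw [← hasSum_extend_zero Subtype.val_injective] at h
  convert h using 1
  funext n
  by_cases h : ∃ a : Λ, (a : ℤ) = n
  · obtain ⟨a, rfl⟩ := h
    simp [extendZero]
  · simp [extendZero, Function.extend_apply' _ _ _ h]

theorem shift_sum_le (k : ℤ) (f : Ell2 Λ) (s : Finset Λ) :
    ∑ n ∈ s, ‖extendZero f ((n : ℤ) + k)‖ ^ 2 ≤ ‖f‖ ^ 2 := by
  have hinj : Function.Injective fun n : Λ => (n : ℤ) + k := fun a b h =>
    Subtype.ext (by simpa using h)
  have := sum_le_hasSum (s.map ⟨_, hinj⟩) (fun n _ => by positivity) (hasSum_sq f)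
  simpa using this

def shift (k : ℤ) : Ell2 Λ →L[ℂ] Ell2 Λ :=
  LinearMap.mkContinuous
    { toFun := fun f => ⟨fun n => extendZero f ((n : ℤ) + k), by
        refine memℓp_gen' (C := ‖f‖ ^ 2) fun s => ?_
        simpa using shift_sum_le k f s⟩
      map_add' := fun f g => lp.ext (funext fun n => extendZero_add f g _)
      map_smul' := fun c f => lp.ext (funext fun n => extendZero_smul c f _) }
    1 fun f => by
      rw [one_mul]
      refine lp.norm_le_of_forall_sum_le (p := 2) (by simp) (norm_nonneg _) fun s => ?_
      simpa using shift_sum_le k f s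

theorem shift_apply (k : ℤ) (f : Ell2 Λ) (n : Λ) : shift k f n = extendZero f ((n : ℤ) + k) := rfl

theorem norm_shift_le (k : ℤ) : ‖(shift k : Ell2 Λ →L[ℂ] Ell2 Λ)‖ ≤ 1 :=
  LinearMap.mkContinuous_norm_le _ zero_le_one _

def phase (V : ℤ → ℝ) (t : ℝ) : Ell2 Λ →L[ℂ] Ell2 Λ :=
  LinearMap.mkContinuous
    { toFun := fun f => ⟨fun n => Complex.exp ((t * V n : ℝ) * Complex.I) * f n, by
        refine (lp.memℓp f).mono' fun n => ?_
        rw [norm_mul, Complex.norm_exp_ofReal_mul_I, one_mul]⟩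
      map_add' := fun f g => lp.ext (funext fun n => mul_add _ _ _)
      map_smul' := fun c f => lp.ext (funext fun n => mul_left_comm _ c _) }
    1 fun f => by
      rw [one_mul]
      refine lp.norm_mono (p := 2) (by simp) fun n => ?_
      show ‖Complex.exp ((t * V n : ℝ) * Complex.I) * f n‖ ≤ ‖f n‖
      rw [norm_mul, Complex.norm_exp_ofReal_mul_I, one_mul]

theorem phase_apply (V : ℤ → ℝ) (t : ℝ) (f : Ell2 Λ) (n : Λ) :
    phase V t f n = Complex.exp ((t * V n : ℝ) * Complex.I) * f n := rfl

theorem norm_phase_le (V : ℤ → ℝ) (t : ℝ) : ‖(phase V t : Ell2 Λ →L[ℂ] Ell2 Λ)‖ ≤ 1 :=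
  LinearMap.mkContinuous_norm_le _ zero_le_one _

theorem continuous_phase (V : ℤ → ℝ) (f : Ell2 Λ) : Continuous fun t => phase V t f := by
  rw [continuous_iff_continuousAt]
  intro s
  rw [ContinuousAt, tendsto_iff_norm_sub_tendsto_zero]
  have key : ∀ t, ‖phase V t f - phase V s f‖ ^ 2 =
      ∑' n : Λ, ‖phase V t f n - phase V s f n‖ ^ 2 := fun t => by
    have h := lp.norm_rpow_eq_tsum (p := 2) (by simp) (phase V t f - phase V s f)
    simpa using h
  have h2 : Tendsto (fun t => ‖phase V t f - phase V s f‖ ^ 2) (𝓝 s) (𝓝 0) := by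
    simp only [key]
    have hs : Summable fun n : Λ => (2 * ‖f n‖) ^ 2 := by
      have h := (lp.hasSum_norm (p := 2) (by simp) f).summable
      simp only [ENNReal.toReal_ofNat, Real.rpow_ofNat] at h
      simpa [mul_pow] using h.mul_left (2 ^ 2)
    rw [show (0 : ℝ) = ∑' _ : Λ, (0 : ℝ) by simp]
    refine tendsto_tsum_of_dominated_convergence hs (fun n => ?_) (Eventually.of_forall fun t n => ?_)
    · have hc : Continuous fun t : ℝ => ‖phase V t f n - phase V s f n‖ ^ 2 := by
        simp only [phase_apply]; fun_prop
      simpa using hc.tendsto s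
    · rw [norm_pow, norm_norm]
      have : ∀ r : ℝ, ‖phase V r f n‖ = ‖f n‖ := fun r => by
        rw [phase_apply, norm_mul, Complex.norm_exp_ofReal_mul_I, one_mul]
      gcongr
      refine (norm_sub_le _ _).trans ?_
      rw [this, this, two_mul]
  have h3 := h2.sqrt
  simpa [Real.sqrt_sq] using h3

theorem exists_weak (V : ℤ → ℝ) (f : Ell2 Λ) : ∃ ψ : ℝ → Ell2 Λ, Continuous ψ ∧ ψ 0 = f ∧
    ∀ t (n : Λ), HasDerivAt (fun s => ψ s n) (-Complex.I * action V (ψ t) n) t := by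
  let B : ℝ → Ell2 Λ →L[ℝ] Ell2 Λ := fun t => ((-Complex.I) • ((phase V t).comp
    ((shift 1 + shift (-1)).comp (phase V (-t))))).restrictScalars ℝ
  have hBa : ∀ t x, B t x = (-Complex.I) • phase V t (shift 1 (phase V (-t) x) +
    shift (-1) (phase V (-t) x)) := fun _ _ => rfl
  have hB : ∀ t, ‖B t‖ ≤ 2 := by
    intro t
    refine ContinuousLinearMap.opNorm_le_bound _ (by norm_num) fun x => ?_
    rw [hBa, norm_smul, norm_neg, Complex.norm_I, one_mul]
    have h1 := (phase V (-t) : Ell2 Λ →L[ℂ] Ell2 Λ).le_of_opNorm_le (norm_phase_le V (-t)) x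
    have h2 := (shift 1 : Ell2 Λ →L[ℂ] Ell2 Λ).le_of_opNorm_le (norm_shift_le 1) (phase V (-t) x)
    have h3 := (shift (-1) : Ell2 Λ →L[ℂ] Ell2 Λ).le_of_opNorm_le (norm_shift_le (-1))
      (phase V (-t) x)
    have h4 := (phase V t : Ell2 Λ →L[ℂ] Ell2 Λ).le_of_opNorm_le (norm_phase_le V t)
      (shift 1 (phase V (-t) x) + shift (-1) (phase V (-t) x))
    have h5 := norm_add_le (shift 1 (phase V (-t) x)) (shift (-1) (phase V (-t) x))
    linarith
  have hph : ∀ {w : ℝ → Ell2 Λ}, Continuous w → Continuous fun t => phase V t (w t) := fun hw =>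
    continuous_apply_of_bdd (fun t => (phase V t).restrictScalars ℝ) 1
      (fun t => by rw [ContinuousLinearMap.norm_restrictScalars]; exact norm_phase_le V t)
      (continuous_phase V) hw
  have hph' : ∀ {w : ℝ → Ell2 Λ}, Continuous w → Continuous fun t => phase V (-t) (w t) :=
    fun {w} hw => by
      have := (hph (w := fun t => w (-t)) (hw.comp continuous_neg)).comp continuous_neg
      simpa [Function.comp_def] using this
  have hc : ∀ x, Continuous fun t => B t x := by
    intro x
    simp only [hBa]
    refine (hph (w := fun t => shift 1 (phase V (-t) x) + shift (-1) (phase V (-t) x)) ?_).const_smul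
      (-Complex.I)
    exact ((shift 1).continuous.comp (hph' continuous_const)).add
      ((shift (-1)).continuous.comp (hph' continuous_const))
  obtain ⟨w, hw0, hw⟩ := exists_linear_ode B 2 hB hc f
  have hwc : Continuous w := continuous_iff_continuousAt.2 fun t => (hw t).continuousAt
  refine ⟨fun t => phase V (-t) (w t), hph' hwc, ?_, fun t n => ?_⟩
  · refine lp.ext (funext fun n => ?_)
    simp [phase_apply, hw0]
  · have e1 : HasDerivAt (fun s => w s n) (B t (w t) n) t :=
      ((lp.evalCLM ℝ (fun _ : Λ => ℂ) 2 n).hasFDerivAt.comp_hasDerivAt t (hw t))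
    have e2 : HasDerivAt (fun s : ℝ => Complex.exp ((-s * V n : ℝ) * Complex.I))
        (Complex.exp ((-t * V n : ℝ) * Complex.I) * (-(V n : ℂ) * Complex.I)) t := by
      have : HasDerivAt (fun s : ℝ => ((-s * V n : ℝ) : ℂ) * Complex.I)
          (-(V n : ℂ) * Complex.I) t := by
        have h := (((hasDerivAt_id t).neg.mul_const (V n)).ofReal_comp).mul_const Complex.I
        simpa using h
      exact this.cexp
    have e3 := e2.mul e1
    refine e3.congr_deriv ?_
    rw [hBa, lp.coeFn_smul, Pi.smul_apply, phase_apply V t]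
    have hexp : Complex.exp ((-t * V n : ℝ) * Complex.I) * Complex.exp ((t * V n : ℝ) * Complex.I)
        = 1 := by
      rw [← Complex.exp_add]; simp
    have e4 : (shift 1 (phase V (-t) (w t)) + shift (-1) (phase V (-t) (w t)) : Ell2 Λ) n =
      extendZero (phase V (-t) (w t)) ((n : ℤ) + 1) +
        extendZero (phase V (-t) (w t)) ((n : ℤ) - 1) := rfl
    rw [e4, action, phase_apply V (-t) (w t) n, smul_eq_mul]
    linear_combination (-Complex.I * (extendZero (phase V (-t) (w t)) ((n : ℤ) + 1) +
        extendZero (phase V (-t) (w t)) ((n : ℤ) - 1))) * hexp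

/-- `ψ t = exp (-i t H) f` for `f` in the domain of `H`: the (unique) strongly differentiable
solution of the Schrödinger equation `ψ' = -i H ψ`, `ψ 0 = f`. -/
def IsEvolution (V : ℤ → ℝ) (f : Ell2 Λ) (ψ : ℝ → Ell2 Λ) : Prop :=
  ψ 0 = f ∧ ∀ t, ∃ h : ψ t ∈ (hamiltonian Λ V).domain,
    HasDerivAt ψ (-Complex.I • hamiltonian Λ V ⟨ψ t, h⟩) t

theorem exists_isEvolution (V : ℤ → ℝ) (f : (hamiltonian Λ V).domain) :
    ∃ ψ : ℝ → Ell2 Λ, IsEvolution V f ψ := by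
  obtain ⟨η, hηc, hη0, hη⟩ := exists_weak V (-Complex.I • hamiltonian Λ V f)
  let ψ : ℝ → Ell2 Λ := fun t => f + ∫ s in (0 : ℝ)..t, η s
  have hψ : ∀ t, HasDerivAt ψ (η t) t := fun t =>
    (intervalIntegral.integral_hasDerivAt_right (hηc.intervalIntegrable _ _)
      (hηc.stronglyMeasurableAtFilter _ _) hηc.continuousAt).const_add _
  have hψn : ∀ (n : Λ) t, HasDerivAt (fun s => ψ s n) (η t n) t := fun n t =>
    ((lp.evalCLM ℝ (fun _ : Λ => ℂ) 2 n).hasFDerivAt.comp_hasDerivAt t (hψ t))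
  have hψe : ∀ (k : ℤ) t, HasDerivAt (fun s => extendZero (ψ s) k) (extendZero (η t) k) t := by
    intro k t
    by_cases h : ∃ a : Λ, (a : ℤ) = k
    · obtain ⟨a, rfl⟩ := h
      simpa [extendZero, Subtype.val_injective.extend_apply] using hψn a t
    · simpa [extendZero, Function.extend_apply' _ _ _ h] using hasDerivAt_const t (0 : ℂ)
  have hψ0 : ψ 0 = f := by simp [ψ]
  have key : ∀ t (n : Λ), η t n = -Complex.I * action V (ψ t) n := by
    intro t n
    have hd : ∀ s, HasDerivAt (fun s => η s n + Complex.I * action V (ψ s) n) 0 s := by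
      intro s
      have h1 : HasDerivAt (fun s => action V (ψ s) n) (action V (η s) n) s :=
        ((hψe _ s).add (hψe _ s)).add ((hψn n s).const_mul _)
      refine ((hη s n).add (h1.const_mul Complex.I)).congr_deriv ?_
      ring
    have hcst := is_const_of_deriv_eq_zero (fun s => (hd s).differentiableAt)
      (fun s => (hd s).deriv) t 0
    have h0 : η 0 n + Complex.I * action V (ψ 0) n = 0 := by
      rw [hη0, hψ0]
      show -Complex.I * action V (f : Ell2 Λ) n + _ = 0
      ring
    simp only [h0] at hcst
    linear_combination hcst
  refine ⟨ψ, hψ0, fun t => ?_⟩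
  have hmem : ψ t ∈ (hamiltonian Λ V).domain := by
    have h : action V (ψ t) = Complex.I • (η t : Λ → ℂ) := by
      funext n
      rw [Pi.smul_apply, smul_eq_mul, key t n, ← mul_assoc]
      simp
    show Memℓp (action V (ψ t)) 2
    rw [h]
    exact (lp.memℓp (η t)).const_smul Complex.I
  refine ⟨hmem, (hψ t).congr_deriv ?_⟩
  exact lp.ext (funext fun n => key t n)

/-! ### Existence of the spectral measure, by approximation with finite boxes -/

theorem exists_matrix_evolution {ι : Type*} [Fintype ι] [DecidableEq ι] (M : Matrix ι ι ℂ)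
    (hM : M.IsHermitian) (j : ι) : ∃ (μ : Measure ℝ) (φ : ℝ → ι → ℂ), IsProbabilityMeasure μ ∧
      (∀ i, φ 0 i = if i = j then 1 else 0) ∧
      (∀ t i, HasDerivAt (fun s => φ s i) (-Complex.I * ∑ l, M i l * φ t l) t) ∧
      (∀ t i, ‖φ t i‖ ≤ 1) ∧
      ∀ t : ℝ, ∫ x : ℝ, Complex.exp (-Complex.I * t * x) ∂μ = φ t j := by
  let U : Matrix ι ι ℂ := hM.eigenvectorUnitary
  let lam : ι → ℝ := hM.eigenvalues
  have hU : ∀ i k, ∑ l, U i l * star (U k l) = if i = k then 1 else 0 := by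
    intro i k
    have h : U * star U = 1 := Unitary.coe_mul_star_self _
    have := congrFun (congrFun h i) k
    simpa [Matrix.mul_apply, Matrix.one_apply] using this
  have hMU : ∀ i l, ∑ m, M i m * U m l = lam l * U i l := by
    intro i l
    have := congrFun (hM.mulVec_eigenvectorBasis l) i
    simp only [Matrix.mulVec, dotProduct, Pi.smul_apply, Complex.real_smul] at this
    exact this
  have hrow : ∀ i, ∑ l, ‖U i l‖ ^ 2 = 1 := by
    intro i
    have := hU i i
    simp only [if_true] at this
    have h2 : ((∑ l, ‖U i l‖ ^ 2 : ℝ) : ℂ) = 1 := by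
      rw [← this]
      push_cast
      refine Finset.sum_congr rfl fun l _ => ?_
      exact (Complex.mul_conj' _).symm
    exact_mod_cast h2
  have hnn : ∀ l, 0 ≤ ‖U j l‖ ^ 2 := fun l => by positivity
  refine ⟨∑ l, ENNReal.ofReal (‖U j l‖ ^ 2) • Measure.dirac (lam l),
    fun t i => ∑ l, U i l * Complex.exp (-Complex.I * t * lam l) * star (U j l),
    ⟨?_⟩, fun i => ?_, fun t i => ?_, fun t i => ?_, fun t => ?_⟩
  · simp only [Measure.coe_finsetSum, Finset.sum_apply, Measure.smul_apply, measure_univ,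
      smul_eq_mul, mul_one]
    rw [← ENNReal.ofReal_sum_of_nonneg fun l _ => hnn l, hrow, ENNReal.ofReal_one]
  · simpa using hU i j
  · have hd : ∀ l, HasDerivAt (fun s : ℝ => U i l * Complex.exp (-Complex.I * s * lam l) *
        star (U j l)) (-Complex.I * (lam l * U i l) * Complex.exp (-Complex.I * t * lam l) *
          star (U j l)) t := by
      intro l
      have h : HasDerivAt (fun s : ℝ => -Complex.I * s * lam l) (-Complex.I * lam l) t := by
        have h := (((hasDerivAt_id t).ofReal_comp).const_mul (-Complex.I)).mul_const (lam l : ℂ)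
        simpa using h
      refine ((h.cexp.const_mul (U i l)).mul_const (star (U j l))).congr_deriv ?_
      ring
    refine (HasDerivAt.fun_sum fun l _ => hd l).congr_deriv ?_
    simp only [← hMU, Finset.mul_sum, Finset.sum_mul]
    rw [Finset.sum_comm]
    refine Finset.sum_congr rfl fun m _ => Finset.sum_congr rfl fun l _ => ?_
    ring
  · have hb : ∀ l, ‖U i l * Complex.exp (-Complex.I * t * lam l) * star (U j l)‖ ≤
        (‖U i l‖ ^ 2 + ‖U j l‖ ^ 2) / 2 := by
      intro l
      have he : -Complex.I * t * lam l = ((-t * lam l : ℝ) : ℂ) * Complex.I := by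
        push_cast; ring
      rw [norm_mul, norm_mul, he, Complex.norm_exp_ofReal_mul_I, mul_one, norm_star]
      nlinarith [sq_nonneg (‖U i l‖ - ‖U j l‖)]
    refine (norm_sum_le _ _).trans ((Finset.sum_le_sum fun l _ => hb l).trans (le_of_eq ?_))
    rw [← Finset.sum_div, Finset.sum_add_distrib, hrow, hrow]
    norm_num
  · have hfin : ∀ l ∈ Finset.univ, Integrable (fun x : ℝ => Complex.exp (-Complex.I * t * x))
        (ENNReal.ofReal (‖U j l‖ ^ 2) • Measure.dirac (lam l)) := fun l _ =>
      (integrable_dirac (by simp)).smul_measure ENNReal.ofReal_ne_top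
    rw [integral_finsetSum_measure hfin]
    refine Finset.sum_congr rfl fun l _ => ?_
    rw [integral_smul_measure, integral_dirac, ENNReal.toReal_ofReal (hnn l)]
    have : U j l * star (U j l) = ((‖U j l‖ ^ 2 : ℝ) : ℂ) := by
      push_cast; exact Complex.mul_conj' _
    rw [Complex.real_smul, ← this]
    ring

theorem exists_box (V : ℤ → ℝ) (k : Λ) (N : ℕ) (hk : |(k : ℤ)| ≤ N) : ∃ μ : Measure ℝ,
    IsProbabilityMeasure μ ∧ ∀ ψ : ℝ → Ell2 Λ, Continuous ψ →
      (∀ n, ψ 0 n = if n = k then 1 else 0) →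
      (∀ t (n : Λ), HasDerivAt (fun s => ψ s n) (-Complex.I * action V (ψ t) n) t) →
      ∀ t : ℝ, ‖∫ x : ℝ, Complex.exp (-Complex.I * t * x) ∂μ - ψ t k‖ ≤
        |∫ r in (0 : ℝ)..t, (‖extendZero (ψ r) (N + 1)‖ + ‖extendZero (ψ r) (-N - 1)‖)| := by
  classical
  let ι := {n : Λ // |(n : ℤ)| ≤ N}
  have hfin : Finite ι := by
    have : Function.Injective fun n : ι => (⟨n.1, abs_le.1 n.2⟩ : Set.Icc (-(N : ℤ)) N) :=
      fun a b h => Subtype.ext (Subtype.ext (Subtype.mk.inj h))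
    exact Finite.of_injective _ this
  have := Fintype.ofFinite ι
  let c : ι → ℤ := fun i => (i.1 : ℤ)
  have hc : Function.Injective c := fun a b h => Subtype.ext (Subtype.ext h)
  let M : Matrix ι ι ℂ := fun i l => (if c l = c i + 1 then 1 else 0) +
    (if c l = c i - 1 then 1 else 0) + if l = i then (V (c i) : ℂ) else 0
  have hsymm : ∀ i l, M i l = M l i := by
    intro i l
    simp only [M]
    rw [add_comm (if c l = c i + 1 then (1 : ℂ) else 0)]
    congr 1
    · congr 1 <;> exact if_congr (by constructor <;> intro h <;> omega) rfl rfl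
    · by_cases h : l = i
      · subst h; rfl
      · rw [if_neg h, if_neg (Ne.symm h)]
  have hM : M.IsHermitian := by
    ext i l
    rw [Matrix.conjTranspose_apply, hsymm i l]
    simp only [M, star_add]
    congr 1
    · congr 1 <;> split_ifs <;> simp
    · split_ifs <;> simp
  -- summation over the box
  have hbox : ∀ (f : Λ → ℂ) (m : ℤ), ∑ l : ι, (if c l = m then f l.1 else 0) =
      if |m| ≤ N then extendZero f m else 0 := by
    intro f m
    by_cases hm : ∃ l : ι, c l = m
    · obtain ⟨l, rfl⟩ := hm
      rw [if_pos l.2, Finset.sum_eq_single l]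
      · rw [if_pos rfl]
        exact (Subtype.val_injective.extend_apply f 0 l.1).symm
      · intro b _ hb
        exact if_neg fun h => hb (hc h)
      · simp
    · rw [Finset.sum_eq_zero fun l _ => if_neg fun h => hm ⟨l, h⟩]
      split_ifs with h
      · refine (Function.extend_apply' (f := Subtype.val) f (0 : ℤ → ℂ) m ?_).symm
        rintro ⟨a, rfl⟩
        exact hm ⟨⟨a, h⟩, rfl⟩
      · rfl
  have hMf : ∀ (f : Λ → ℂ) (i : ι), action V f i.1 = ∑ l, M i l * f l.1 +
      ((if c i = N then extendZero f (N + 1) else 0) +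
        if c i = -N then extendZero f (-N - 1) else 0) := by
    intro f i
    have e : ∑ l, M i l * f l.1 = (if |c i + 1| ≤ N then extendZero f (c i + 1) else 0) +
        (if |c i - 1| ≤ N then extendZero f (c i - 1) else 0) + V (c i) * f i.1 := by
      rw [← hbox, ← hbox]
      simp only [M, add_mul, ite_mul, one_mul, zero_mul, Finset.sum_add_distrib]
      congr 1
      rw [Finset.sum_ite_eq' Finset.univ i]
      simp
    have hi := abs_le.1 i.2
    have e1 : extendZero f (c i + 1) = (if |c i + 1| ≤ N then extendZero f (c i + 1) else 0) +
        if c i = N then extendZero f (N + 1) else 0 := by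
      by_cases h : c i = N
      · rw [if_pos h, if_neg (by rw [h, abs_le]; omega), h, zero_add]
      · have : |c i + 1| ≤ N := by rw [abs_le]; constructor <;> simp only [c] at h ⊢ <;> omega
        rw [if_neg h, if_pos this, add_zero]
    have e2 : extendZero f (c i - 1) = (if |c i - 1| ≤ N then extendZero f (c i - 1) else 0) +
        if c i = -N then extendZero f (-N - 1) else 0 := by
      by_cases h : c i = -N
      · rw [if_pos h, if_neg (by rw [h, abs_le]; omega), h, zero_add]
      · have : |c i - 1| ≤ N := by rw [abs_le]; constructor <;> simp only [c] at h ⊢ <;> omega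
        rw [if_neg h, if_pos this, add_zero]
    rw [e]
    show extendZero f (c i + 1) + extendZero f (c i - 1) + V (c i) * f i.1 = _
    linear_combination e1 + e2
  let k' : ι := ⟨k, hk⟩
  obtain ⟨μ, φ, hμ, hφ0, hφ, hφ1, hφμ⟩ := exists_matrix_evolution M hM k'
  refine ⟨μ, hμ, fun ψ hψc hψ0 hψ t => ?_⟩
  let b : ℝ → ι → ℂ := fun r i => (if c i = N then extendZero (ψ r) (N + 1) else 0) +
        if c i = -N then extendZero (ψ r) (-N - 1) else 0
  have hext : ∀ m : ℤ, Continuous fun r => extendZero (ψ r) m := by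
    intro m
    by_cases h : ∃ a : Λ, (a : ℤ) = m
    · obtain ⟨a, rfl⟩ := h
      have : Continuous fun r => ψ r a := continuous_iff_continuousAt.2 fun r =>
        (hψ r a).continuousAt
      simpa [extendZero, Subtype.val_injective.extend_apply] using this
    · simp [extendZero, Function.extend_apply' _ _ _ h, continuous_const]
  have hbc : ∀ i, Continuous fun r => b r i := by
    intro i
    refine Continuous.add ?_ ?_
    · split_ifs
      exacts [hext _, continuous_const]
    · split_ifs
      exacts [hext _, continuous_const]
  have hg : ∀ r, HasDerivAt (fun r => ∑ i, φ (t - r) i * ψ r i.1)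
      (∑ i, -Complex.I * (φ (t - r) i * b r i)) r := by
    intro r
    have h1 : ∀ i, HasDerivAt (fun r => φ (t - r) i * ψ r i.1)
        (-(-Complex.I * ∑ l, M i l * φ (t - r) l) * ψ r i.1 +
          φ (t - r) i * (-Complex.I * action V (ψ r) i.1)) r := by
      intro i
      have h2 : HasDerivAt (fun r => φ (t - r) i)
          (-(-Complex.I * ∑ l, M i l * φ (t - r) l)) r := by
        have := (hφ (t - r) i).scomp r ((hasDerivAt_id r).const_sub t)
        simpa [Function.comp_def] using this
      exact h2.mul (hψ r i.1)
    refine (HasDerivAt.fun_sum fun i _ => h1 i).congr_deriv ?_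
    have hsw : ∑ i, (∑ l, M i l * φ (t - r) l) * ψ r i.1 =
        ∑ i, φ (t - r) i * ∑ l, M i l * ψ r l.1 := by
      simp only [Finset.sum_mul, Finset.mul_sum]
      rw [Finset.sum_comm]
      refine Finset.sum_congr rfl fun i _ => Finset.sum_congr rfl fun l _ => ?_
      rw [hsymm]; ring
    have : ∀ i, -(-Complex.I * ∑ l, M i l * φ (t - r) l) * ψ r i.1 +
          φ (t - r) i * (-Complex.I * action V (ψ r) i.1) =
        Complex.I * ((∑ l, M i l * φ (t - r) l) * ψ r i.1 -
          φ (t - r) i * ∑ l, M i l * ψ r l.1) + -Complex.I * (φ (t - r) i * b r i) := by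
      intro i
      rw [hMf]
      ring
    simp only [this, Finset.sum_add_distrib, ← Finset.mul_sum, Finset.sum_sub_distrib, hsw]
    ring
  have hφc : ∀ i, Continuous fun r => φ (t - r) i := fun i =>
    (continuous_iff_continuousAt.2 fun r => (hφ r i).continuousAt).comp (by fun_prop)
  have hint := intervalIntegral.integral_eq_sub_of_hasDerivAt (a := 0) (b := t)
    (fun r _ => hg r) (Continuous.intervalIntegrable (continuous_finsetSum _ fun i _ =>
      ((hφc i).mul (hbc i)).const_mul _) _ _)
  have ht : ∑ i, φ (t - t) i * ψ t i.1 = ψ t k := by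
    rw [Finset.sum_eq_single k']
    · simp [hφ0, k']
    · intro i _ hi
      rw [sub_self, hφ0, if_neg hi, zero_mul]
    · simp
  have h0 : ∑ i, φ (t - 0) i * ψ 0 i.1 = φ t k' := by
    rw [Finset.sum_eq_single k']
    · simp [hψ0, k']
    · intro i _ hi
      rw [hψ0, if_neg fun h => hi (Subtype.ext h), mul_zero]
    · simp
  rw [ht, h0] at hint
  rw [hφμ, norm_sub_rev, ← hint]
  refine intervalIntegral.norm_integral_le_abs_of_norm_le (Eventually.of_forall fun r => ?_)
    (((hext _).norm.add (hext _).norm).intervalIntegrable _ _)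
  have hone : ∀ (m : ℤ) (z : ℂ), ∑ i : ι, ‖if c i = m then z else 0‖ ≤ ‖z‖ := by
    intro m z
    by_cases hm : ∃ l : ι, c l = m
    · obtain ⟨l, rfl⟩ := hm
      rw [Finset.sum_eq_single l]
      · rw [if_pos rfl]
      · intro b _ hb
        rw [if_neg fun h => hb (hc h), norm_zero]
      · simp
    · rw [Finset.sum_eq_zero fun l _ => by rw [if_neg fun h => hm ⟨l, h⟩, norm_zero]]
      exact norm_nonneg _
  calc ‖∑ i, -Complex.I * (φ (t - r) i * b r i)‖
      ≤ ∑ i, ‖-Complex.I * (φ (t - r) i * b r i)‖ := norm_sum_le _ _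
    _ ≤ ∑ i, (‖if c i = N then extendZero (ψ r) (N + 1) else 0‖ +
        ‖if c i = -N then extendZero (ψ r) (-N - 1) else 0‖) := by
      refine Finset.sum_le_sum fun i _ => ?_
      rw [norm_mul, norm_mul, norm_neg, Complex.norm_I, one_mul]
      refine (mul_le_of_le_one_left (norm_nonneg _) (hφ1 _ _)).trans (norm_add_le _ _)
    _ ≤ _ := by
      rw [Finset.sum_add_distrib]
      exact add_le_add (hone _ _) (hone _ _)

theorem exists_spectral (V : ℤ → ℝ) (k : Λ) (ψ : ℝ → Ell2 Λ) (hψc : Continuous ψ)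
    (hψ0 : ∀ n, ψ 0 n = if n = k then 1 else 0)
    (hψ : ∀ t (n : Λ), HasDerivAt (fun s => ψ s n) (-Complex.I * action V (ψ t) n) t) :
    ∃ μ : Measure ℝ, IsProbabilityMeasure μ ∧
      ∀ t : ℝ, ∫ x : ℝ, Complex.exp (-Complex.I * t * x) ∂μ = ψ t k := by
  choose μ hμ hb using fun N : ℕ => exists_box V k (N + (k : ℤ).natAbs)
    (by rw [Int.abs_eq_natAbs]; omega)
  have hle : ∀ (f : Ell2 Λ) (m : ℤ), ‖extendZero f m‖ ≤ ‖f‖ := by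
    intro f m
    have := le_hasSum (hasSum_sq f) m fun _ _ => by positivity
    exact le_of_sq_le_sq this (norm_nonneg _)
  have hz : ∀ (f : Ell2 Λ), Tendsto (fun m => ‖extendZero f m‖) cofinite (𝓝 0) := by
    intro f
    have := (hasSum_sq f).summable.tendsto_cofinite_zero.sqrt
    simpa [Real.sqrt_sq] using this
  have hext : ∀ m : ℤ, Continuous fun r => extendZero (ψ r) m := by
    intro m
    by_cases h : ∃ a : Λ, (a : ℤ) = m
    · obtain ⟨a, rfl⟩ := h
      have : Continuous fun r => ψ r a := continuous_iff_continuousAt.2 fun r =>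
        (hψ r a).continuousAt
      simpa [extendZero, Subtype.val_injective.extend_apply] using this
    · simp [extendZero, Function.extend_apply' _ _ _ h, continuous_const]
  have hlim : ∀ t : ℝ, Tendsto (fun N => ∫ x : ℝ, Complex.exp (-Complex.I * t * x) ∂(μ N)) atTop
      (𝓝 (ψ t k)) := by
    intro t
    rw [tendsto_iff_norm_sub_tendsto_zero]
    refine squeeze_zero (fun _ => norm_nonneg _) (fun N => hb N ψ hψc hψ0 hψ t) ?_
    suffices h : Tendsto (fun N : ℕ => ∫ r in (0 : ℝ)..t,
        (‖extendZero (ψ r) ((N + (k : ℤ).natAbs : ℕ) + 1)‖ +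
          ‖extendZero (ψ r) (-(N + (k : ℤ).natAbs : ℕ) - 1)‖)) atTop
        (𝓝 (∫ _ in (0 : ℝ)..t, (0 : ℝ))) by
      have h' := h.abs
      rwa [intervalIntegral.integral_zero, abs_zero] at h'
    refine intervalIntegral.tendsto_integral_filter_of_dominated_convergence (μ := volume)
      (fun r => ‖ψ r‖ + ‖ψ r‖) (Eventually.of_forall fun N => ?_)
      (Eventually.of_forall fun N => Eventually.of_forall fun r _ => ?_)
      ((hψc.norm.add hψc.norm).intervalIntegrable _ _) (Eventually.of_forall fun r _ => ?_)
    · exact ((hext _).norm.add (hext _).norm).aestronglyMeasurable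
    · rw [Real.norm_of_nonneg (by positivity)]
      exact add_le_add (hle _ _) (hle _ _)
    · have i1 : Function.Injective fun N : ℕ => (((N + (k : ℤ).natAbs : ℕ) : ℤ) + 1) :=
        fun a b h => by simp only at h; omega
      have i2 : Function.Injective fun N : ℕ => (-((N + (k : ℤ).natAbs : ℕ) : ℤ) - 1) :=
        fun a b h => by simp only at h; omega
      have t1 := (hz (ψ r)).comp i1.tendsto_cofinite
      have t2 := (hz (ψ r)).comp i2.tendsto_cofinite
      rw [Nat.cofinite_eq_atTop] at t1 t2
      simpa using t1.add t2
  have hchar : ∀ t : ℝ, Tendsto (fun N => charFun (μ N) t) atTop (𝓝 (ψ (-t) k)) := by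
    intro t
    refine (hlim (-t)).congr fun N => ?_
    rw [charFun_apply_real]
    refine integral_congr_ae (Eventually.of_forall fun x => ?_)
    simp only
    congr 1
    push_cast
    ring
  have hcont : Continuous fun t => ψ (-t) k :=
    (continuous_iff_continuousAt.2 fun r => (hψ r k).continuousAt).comp continuous_neg
  have htight := isTightMeasureSet_of_tendsto_charFun hcont.continuousAt hchar
  let P : ℕ → ProbabilityMeasure ℝ := fun N => ⟨μ N, hμ N⟩
  have hcomp : IsCompact (closure (Set.range P)) := by
    refine isCompact_closure_of_isTightMeasureSet ?_
    convert htight using 1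
    ext ν
    constructor
    · rintro ⟨_, ⟨N, rfl⟩, rfl⟩
      exact ⟨N, rfl⟩
    · rintro ⟨N, rfl⟩
      exact ⟨P N, ⟨N, rfl⟩, rfl⟩
  obtain ⟨Q, -, σ, hσ, hQ⟩ := hcomp.tendsto_subseq fun N => subset_closure (Set.mem_range_self N)
  refine ⟨Q, inferInstance, fun t => ?_⟩
  have h1 := (ProbabilityMeasure.tendsto_iff_tendsto_charFun.1 hQ) (-t)
  have h2 := (hchar (-t)).comp hσ.tendsto_atTop
  have h3 := tendsto_nhds_unique h1 h2
  rw [neg_neg] at h3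
  rw [← h3, charFun_apply_real]
  refine integral_congr_ae (Eventually.of_forall fun x => ?_)
  simp only
  congr 1
  push_cast
  ring

/-! ### Uniqueness of the time evolution -/

/-- `H` is symmetric. -/
theorem hamiltonian_symm (V : ℤ → ℝ) (f g : (hamiltonian Λ V).domain) :
    inner ℂ (hamiltonian Λ V f) (g : Ell2 Λ) = inner ℂ (f : Ell2 Λ) (hamiltonian Λ V g) := by
  have hext : ∀ (a : Ell2 Λ) (n : Λ), extendZero a (n : ℤ) = a n := fun a n =>
    Subtype.val_injective.extend_apply _ _ _
  -- inner products as sums over `ℤ`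
  have hz : ∀ (a b : Ell2 Λ) (k : ℤ), HasSum
      (fun n : ℤ => extendZero b (n + k) * star (extendZero a n))
      (inner ℂ a (shift k b)) := by
    intro a b k
    have h := lp.hasSum_inner (𝕜 := ℂ) a (shift k b)
    rw [← hasSum_extend_zero Subtype.val_injective] at h
    refine (congrArg (fun F : ℤ → ℂ => HasSum F (inner ℂ a (shift k b))) (funext fun n => ?_)).mpr h
    by_cases hn : ∃ c : Λ, (c : ℤ) = n
    · obtain ⟨c, rfl⟩ := hn
      rw [Subtype.val_injective.extend_apply, hext, shift_apply]
      simp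
    · simp [extendZero, Function.extend_apply' _ _ _ hn]
  have hshift : ∀ (a b : Ell2 Λ) (k : ℤ), inner ℂ (shift k a) b = inner ℂ a (shift (-k) b) := by
    intro a b k
    have h1 := (hz b a k).star
    rw [starRingEnd_apply .. |>.symm, inner_conj_symm] at h1
    have h2 := (Equiv.addRight (-k)).hasSum_iff.2 h1
    refine h2.unique ?_
    refine (congrArg (fun F : ℤ → ℂ => HasSum F (inner ℂ a (shift (-k) b)))
      (funext fun n => ?_)).mpr (hz a b (-k))
    simp
    ring
  have hV : ∀ a : (hamiltonian Λ V).domain, ∃ w : Ell2 Λ, (∀ n, w n = V n * (a : Ell2 Λ) n) ∧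
      hamiltonian Λ V a = shift 1 (a : Ell2 Λ) + shift (-1) (a : Ell2 Λ) + w := by
    intro a
    refine ⟨hamiltonian Λ V a - (shift 1 (a : Ell2 Λ) + shift (-1) (a : Ell2 Λ)), fun n => ?_, by abel⟩
    show action V (a : Ell2 Λ) n - (extendZero (a : Ell2 Λ) ((n : ℤ) + 1) +
      extendZero (a : Ell2 Λ) ((n : ℤ) + -1)) = _
    rw [action, sub_eq_add_neg (n : ℤ)]; ring
  obtain ⟨v, hv, ef⟩ := hV f
  obtain ⟨w, hw, eg⟩ := hV g
  have hvw : inner ℂ v (g : Ell2 Λ) = inner ℂ (f : Ell2 Λ) w := by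
    rw [lp.inner_eq_tsum, lp.inner_eq_tsum]
    refine tsum_congr fun n => ?_
    rw [hv, hw]
    simp
    ring
  rw [ef, eg]
  simp only [inner_add_left, inner_add_right, hshift, hvw, neg_neg]
  ring

/-- The time evolution is unique. -/
theorem evolution_unique (V : ℤ → ℝ) (f : Ell2 Λ) (ψ χ : ℝ → Ell2 Λ) (hψ : IsEvolution V f ψ)
    (hχ : IsEvolution V f χ) : ψ = χ := by
  have hd : ∀ t, HasDerivAt (fun s => ‖ψ s - χ s‖ ^ 2) 0 t := by
    intro t
    obtain ⟨h1, d1⟩ := hψ.2 t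
    obtain ⟨h2, d2⟩ := hχ.2 t
    have h3 := (d1.sub d2).norm_sq
    refine h3.congr_deriv ?_
    let u : (hamiltonian Λ V).domain := ⟨ψ t, h1⟩ - ⟨χ t, h2⟩
    have e1 : -Complex.I • hamiltonian Λ V ⟨ψ t, h1⟩ - -Complex.I • hamiltonian Λ V ⟨χ t, h2⟩ =
        -Complex.I • hamiltonian Λ V u := by
      rw [← smul_sub, ← LinearPMap.map_sub]
    rw [e1]
    have hs := hamiltonian_symm V u u
    have him : (inner ℂ (u : Ell2 Λ) (hamiltonian Λ V u)).im = 0 := by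
      rw [← inner_conj_symm] at hs
      exact Complex.conj_eq_iff_im.1 hs
    have hre : ∀ x y : Ell2 Λ, inner ℝ x y = (inner ℂ x y).re := fun x y =>
      (lp.hasSum_inner (𝕜 := ℝ) x y).unique
        ((lp.hasSum_inner (𝕜 := ℂ) x y).mapL Complex.reCLM)
    have eu : (ψ - χ) t = (u : Ell2 Λ) := rfl
    rw [eu, hre]
    rw [inner_smul_right]
    simp [him]
  funext t
  have := is_const_of_deriv_eq_zero (fun s => (hd s).differentiableAt) (fun s => (hd s).deriv) t 0
  simp only [hψ.1, hχ.1, sub_self, norm_zero] at this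
  have h2 : ‖ψ t - χ t‖ = 0 := by simpa using this
  exact sub_eq_zero.1 (norm_eq_zero.1 h2)

/-! ### The dynamics and the spectral measure of `δ_1` -/

theorem delta_mem_domain (V : ℤ → ℝ) (k : ℤ) : delta Λ k ∈ (hamiltonian Λ V).domain := by
  have h : action V (delta Λ k) =
      ((shift 1 (delta Λ k) + shift (-1) (delta Λ k) + (V k : ℂ) • delta Λ k : Ell2 Λ) : Λ → ℂ) := by
    funext n
    show extendZero (delta Λ k) ((n : ℤ) + 1) + extendZero (delta Λ k) ((n : ℤ) - 1) +
      (V n : ℂ) * delta Λ k n = extendZero (delta Λ k) ((n : ℤ) + 1) +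
        extendZero (delta Λ k) ((n : ℤ) + -1) + (V k : ℂ) * delta Λ k n
    by_cases hn : (n : ℤ) = k
    · rw [hn]; rfl
    · have : delta Λ k n = 0 := by
        unfold delta
        split_ifs with hk
        · rw [lp.single_apply_ne]
          exact fun e => hn (congrArg Subtype.val e)
        · rfl
      rw [this]; simp [sub_eq_add_neg]
  show Memℓp (action V (delta Λ k)) 2
  rw [h]
  exact lp.memℓp _

/-- `ψ t = exp (-i t H) δ_1`. -/
def evolution (Λ : Set ℤ) (V : ℤ → ℝ) : ℝ → Ell2 Λ :=
  (exists_isEvolution V ⟨delta Λ 1, delta_mem_domain V 1⟩).choose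

theorem evolution_spec (Λ : Set ℤ) (V : ℤ → ℝ) : IsEvolution V (delta Λ 1) (evolution Λ V) :=
  (exists_isEvolution V ⟨delta Λ 1, delta_mem_domain V 1⟩).choose_spec

theorem inner_delta {k : ℤ} (hk : k ∈ Λ) (f : Ell2 Λ) : inner ℂ (delta Λ k) f = f ⟨k, hk⟩ := by
  rw [delta, dif_pos hk, lp.inner_single_left]
  simp

theorem exists_spectralMeasure (Λ : Set ℤ) (V : ℤ → ℝ) : ∃ μ : Measure ℝ, IsFiniteMeasure μ ∧
    ∀ t : ℝ, ∫ x : ℝ, Complex.exp (-Complex.I * t * x) ∂μ =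
      inner ℂ (delta Λ 1) (evolution Λ V t) := by
  by_cases h1 : (1 : ℤ) ∈ Λ
  · obtain ⟨h0, hd⟩ := evolution_spec Λ V
    have hc : Continuous (evolution Λ V) := continuous_iff_continuousAt.2 fun t => by
      obtain ⟨_, h⟩ := hd t
      exact h.continuousAt
    obtain ⟨μ, hμ, h⟩ := exists_spectral V ⟨1, h1⟩ (evolution Λ V) hc (fun n => by
      rw [h0, delta, dif_pos h1, lp.single_apply, Pi.single_apply]) (fun t n => by
      obtain ⟨_, h⟩ := hd t
      exact (lp.evalCLM ℝ (fun _ : Λ => ℂ) 2 n).hasFDerivAt.comp_hasDerivAt t h)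
    exact ⟨μ, inferInstance, fun t => by rw [h, inner_delta h1]⟩
  · exact ⟨0, inferInstance, fun t => by simp [delta, h1]⟩

/-- The spectral measure `μ` of `H` and `δ_1`: the finite Borel measure on `ℝ` (unique, since its
Fourier transform is prescribed) with `⟨δ_1, exp (-i t H) δ_1⟩ = ∫ exp (-i t x) dμ(x)` for all
real `t`. -/
def spectralMeasure (Λ : Set ℤ) (V : ℤ → ℝ) : Measure ℝ := (exists_spectralMeasure Λ V).choose

theorem spectralMeasure_spec (Λ : Set ℤ) (V : ℤ → ℝ) : IsFiniteMeasure (spectralMeasure Λ V) ∧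
    ∀ t : ℝ, ∫ x : ℝ, Complex.exp (-Complex.I * t * x) ∂(spectralMeasure Λ V) =
      inner ℂ (delta Λ 1) (evolution Λ V t) :=
  (exists_spectralMeasure Λ V).choose_spec

/-- The spectral measure is unique. -/
theorem spectralMeasure_unique (Λ : Set ℤ) (V : ℤ → ℝ) (μ : Measure ℝ) [IsFiniteMeasure μ]
    (h : ∀ t : ℝ, ∫ x : ℝ, Complex.exp (-Complex.I * t * x) ∂μ =
      inner ℂ (delta Λ 1) (evolution Λ V t)) : μ = spectralMeasure Λ V := by
  obtain ⟨hfin, hs⟩ := spectralMeasure_spec Λ V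
  refine Measure.ext_of_charFun (funext fun t => ?_)
  have h1 := (h (-t)).trans (hs (-t)).symm
  have e : ∀ ν : Measure ℝ, charFun ν t =
      ∫ x : ℝ, Complex.exp (-Complex.I * ((-t : ℝ) : ℂ) * x) ∂ν := fun ν => by
    rw [charFun_apply_real]
    refine integral_congr_ae (Eventually.of_forall fun x => ?_)
    simp only
    congr 1
    push_cast
    ring
  rw [e, e, h1]

/-- The Borel transform `F z = ∫ dμ(x) / (x - z)` of the spectral measure of `δ_1`. -/
def borelTransform (Λ : Set ℤ) (V : ℤ → ℝ) (z : ℂ) : ℂ :=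
  ∫ x : ℝ, 1 / ((x : ℂ) - z) ∂(spectralMeasure Λ V)

/-- `a(n,T) = (1/T) ∫_0^∞ exp (-2t/T) |⟨δ_n, exp (-i t H) δ_1⟩|² dt`. It vanishes for `n ∉ Λ`. -/
def avgProb (Λ : Set ℤ) (V : ℤ → ℝ) (n : ℤ) (T : ℝ) : ℝ :=
  1 / T * ∫ t in Set.Ioi (0 : ℝ), Real.exp (-2 * t / T) *
    ‖inner ℂ (delta Λ n) (evolution Λ V t)‖ ^ 2

/-- The time-averaged probability `∑_{|n| ≥ R} a(n,T)` of being at distance at least `R`. -/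
def outsideProb (Λ : Set ℤ) (V : ℤ → ℝ) (R T : ℝ) : ℝ≥0∞ :=
  ∑' n : {n : ℤ // R ≤ |(n : ℝ)|}, ENNReal.ofReal (avgProb Λ V n T)

/-- The time-averaged moment `⟨|X|^p⟩(T) = ∑_n |n|^p a(n,T)`. -/
def moment (Λ : Set ℤ) (V : ℤ → ℝ) (p T : ℝ) : ℝ≥0∞ :=
  ∑' n : ℤ, ENNReal.ofReal (|(n : ℝ)| ^ p * avgProb Λ V n T)

/-- The lower growth exponent `β⁻(p) = liminf_{T → ∞} log ⟨|X|^p⟩(T) / log T`. -/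
def lowerExponent (Λ : Set ℤ) (V : ℤ → ℝ) (p : ℝ) : EReal :=
  liminf (fun T : ℝ => ENNReal.log (moment Λ V p T) / ((Real.log T : ℝ) : EReal)) atTop

/-! ### Transfer matrices -/

/-- The one-step transfer matrix at the site `n`. -/
def stepMatrix (V : ℤ → ℝ) (E : ℝ) (n : ℤ) : Matrix (Fin 2) (Fin 2) ℝ := !![E - V n, -1; 1, 0]

/-- The product of the one-step matrices of the sites `m + k, …, m + 1`. -/
def transferUp (V : ℤ → ℝ) (E : ℝ) (m : ℤ) : ℕ → Matrix (Fin 2) (Fin 2) ℝ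
  | 0 => 1
  | k + 1 => stepMatrix V E (m + (k + 1 : ℕ)) * transferUp V E m k

/-- The transfer matrix `T(n,m;E)`, which maps `(φ (m + 1), φ m)` to `(φ (n + 1), φ n)` for every
solution of `φ (n + 1) + φ (n - 1) + V n * φ n = E * φ n`. For `n < m` it is the inverse of
`T(m,n;E)`, whose determinant is `1`. -/
def transfer (V : ℤ → ℝ) (E : ℝ) (n m : ℤ) : Matrix (Fin 2) (Fin 2) ℝ :=
  if m ≤ n then transferUp V E m (n - m).toNat else (transferUp V E n (m - n).toNat)⁻¹

/-- The closed `r`-neighbourhood `{E | ∃ E' ∈ A, |E - E'| ≤ r}` of `A`. -/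
def nbhd (A : Set ℝ) (r : ℝ) : Set ℝ := {E | ∃ E' ∈ A, |E - E'| ≤ r}

/-- The length scale `N(T) = T ^ (1 / (1 + α))`. -/
def scale (α T : ℝ) : ℝ := T ^ (1 / (1 + α))


theorem det_transferUp (V : ℤ → ℝ) (E : ℝ) (m : ℤ) (k : ℕ) : (transferUp V E m k).det = 1 := by
  induction k with
  | zero => simp [transferUp]
  | succ k ih => rw [transferUp, Matrix.det_mul, ih]; simp [stepMatrix, Matrix.det_fin_two]

/-- The defining property of the transfer matrix. -/
theorem transfer_mulVec (V : ℤ → ℝ) (E : ℝ) (φ : ℤ → ℝ)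
    (hφ : ∀ n, φ (n + 1) + φ (n - 1) + V n * φ n = E * φ n) (n m : ℤ) :
    (transfer V E n m).mulVec ![φ (m + 1), φ m] = ![φ (n + 1), φ n] := by
  have up : ∀ (m : ℤ) (k : ℕ), (transferUp V E m k).mulVec ![φ (m + 1), φ m] =
      ![φ (m + k + 1), φ (m + k)] := by
    intro m k
    induction k with
    | zero => simp [transferUp]
    | succ k ih =>
      have h := hφ (m + (k + 1 : ℕ))
      rw [show m + ((k + 1 : ℕ) : ℤ) - 1 = m + k by push_cast; ring] at h
      rw [transferUp, ← Matrix.mulVec_mulVec, ih]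
      have e : m + (k : ℤ) + 1 = m + ((k + 1 : ℕ) : ℤ) := by push_cast; ring
      rw [e]
      ext i
      fin_cases i
      · simp [stepMatrix, Matrix.mulVec, dotProduct, Fin.sum_univ_two] at h ⊢
        linarith
      · simp [stepMatrix, Matrix.mulVec, dotProduct, Fin.sum_univ_two]
  unfold transfer
  split_ifs with h
  · rw [up, Int.toNat_of_nonneg (by omega), add_sub_cancel]
  · have h1 := up n (m - n).toNat
    rw [Int.toNat_of_nonneg (by omega), add_sub_cancel] at h1
    rw [← h1, Matrix.mulVec_mulVec, Matrix.nonsing_inv_mul _ (by simp [det_transferUp]),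
      Matrix.one_mulVec]

end Schrodinger
end

open Schrodinger

/-!
By Parseval's identity in time (`ofReal_avgProb`), `a(n,T)` equals `1 / (2 π T)` times the integral
over `E` of `|u(n)|²`, where `u(n) = ⟨δ_n, (H - z)⁻¹ δ_1⟩` and `z = E + i / T`. Away from the site
`1` the sequence `u` solves the difference equation at the energy `z`, and at the site `1` the source
`δ_1` together with `u(1) = F(z)` bounds `1 + |F(z)|²` by `|u(0)|² + |u(1)|² + |u(2)|²`
(`green_source`).

Suppose that the transfer matrices are bounded by `C N ^ α` up to the scale `N` at some energy
within `3 / T` of `E`. With `N = T ^ (1 / (1 + α))` the product of this bound, the distance of the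
energies and the length `N` stays bounded, so that a discrete Gronwall argument carries the bound
over to `z` up to a constant factor (`stateNorm_right_le`, `stateNorm_left_le`). A solution can then
have decayed at most by the factor `C N ^ α` between the source and any site `n` with
`N / 2 ≤ |n| ≤ N`. Summing over these sites gives
`∑ |u(n)|² ≥ c N ^ (1 - 2 α) (1 + |F(z)|²)` (`le_tsum_green`), and integrating over the energies
gives the basic estimate `exists_le_outsideProb`, with constants that do not depend on the set of
energies. Parts (a), (b) and the first half of (c) follow from `1 + |F|² ≥ Im F`, since `Im F` is the
Poisson integral of the spectral measure (`spectralMeasure_cthickening_le`), and from `|n| ≥ N / 2`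
in the sum over `n`.

At an eigenvalue `E₀` the eigenvector is square summable but decays at most like `n ^ (-α)`, which
forces `α > 1/2`. If it does not vanish at `1`, then `Im F` is of order `T` for `|E - E₀| ≤ 1 / T`
(`im_borelTransform_ge_of_eigenvector`), and the term `|F|²` in the basic estimate, which is
quadratic in `T`, yields the better exponent.
-/


noncomputable section

namespace Schrodinger

/-! ### Plancherel's theorem for integrable and square integrable functions -/

open FourierTransform in
/-- On `L¹ ∩ L²` the `L²` Fourier transform is given by the integral, since both represent the same
tempered distribution. -/
theorem fourier_toLp_ae_eq {f : ℝ → ℂ} (hf : Integrable f) (hf2 : MemLp f 2) :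
    (𝓕 (hf2.toLp f) : Lp ℂ 2 (volume : Measure ℝ)) =ᵐ[volume] 𝓕 f := by
  have hcont : Continuous (𝓕 f) := VectorFourier.fourierIntegral_continuous
    Real.continuous_fourierChar continuous_inner hf
  refine ae_eq_of_integral_contDiff_smul_eq
    ((Lp.memLp (𝓕 (hf2.toLp f) : Lp ℂ 2 (volume : Measure ℝ))).locallyIntegrable (by norm_num))
    hcont.locallyIntegrable fun g hg hgc => ?_
  have hgc' : HasCompactSupport (Complex.ofRealCLM ∘ g) := hgc.comp_left rfl
  let φ : SchwartzMap ℝ ℂ := hgc'.toSchwartzMap (Complex.ofRealCLM.contDiff.comp hg)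
  have hφ : ∀ x, φ x = (g x : ℂ) := fun x => rfl
  have h1 := congrArg (fun T => T φ) (Lp.fourier_toTemperedDistribution_eq (hf2.toLp f))
  simp only [TemperedDistribution.fourier_apply, Lp.toTemperedDistribution_apply] at h1
  have h2 : ∫ x, (𝓕 φ : SchwartzMap ℝ ℂ) x • (hf2.toLp f : Lp ℂ 2 (volume : Measure ℝ)) x =
      ∫ x, f x • 𝓕 (φ : ℝ → ℂ) x := by
    refine integral_congr_ae ?_
    filter_upwards [hf2.coeFn_toLp] with x hx
    rw [hx, smul_eq_mul, smul_eq_mul, mul_comm, SchwartzMap.fourier_coe]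
  have h3 : ∫ x, 𝓕 f x • φ x = ∫ x, f x • 𝓕 (φ : ℝ → ℂ) x :=
    by
    simpa using! VectorFourier.integral_fourierIntegral_smul_eq_flip (L := innerₗ ℝ)
      Real.continuous_fourierChar continuous_inner hf φ.integrable
  calc ∫ x, g x • (𝓕 (hf2.toLp f) : Lp ℂ 2 (volume : Measure ℝ)) x
      = ∫ x, φ x • (𝓕 (hf2.toLp f) : Lp ℂ 2 (volume : Measure ℝ)) x := by
        refine integral_congr_ae (Eventually.of_forall fun x => ?_)
        simp only [hφ, Complex.real_smul, smul_eq_mul]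
    _ = ∫ x, 𝓕 f x • φ x := by rw [← h1, h2, h3]
    _ = ∫ x, g x • 𝓕 f x := by
        refine integral_congr_ae (Eventually.of_forall fun x => ?_)
        simp only [hφ, Complex.real_smul, smul_eq_mul, mul_comm]

open FourierTransform in
theorem lintegral_enorm_fourier_sq {f : ℝ → ℂ} (hf : Integrable f) (hf2 : MemLp f 2) :
    ∫⁻ ξ, ‖𝓕 f ξ‖ₑ ^ 2 = ∫⁻ t, ‖f t‖ₑ ^ 2 := by
  have key : ∀ (g : ℝ → ℂ), eLpNorm g 2 volume ^ 2 = ∫⁻ t, ‖g t‖ₑ ^ 2 := fun g => by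
    have := eLpNorm_nnreal_pow_eq_lintegral (f := g) (μ := volume) (p := 2) (by norm_num)
    simpa using this
  rw [← key, ← key, ← eLpNorm_congr_ae (fourier_toLp_ae_eq hf hf2),
    ← eLpNorm_congr_ae hf2.coeFn_toLp, ← Lp.enorm_def, ← Lp.enorm_def]
  congr 1
  rw [← ofReal_norm, ← ofReal_norm, Lp.norm_fourier_eq]

/-- Plancherel's theorem in the normalisation `∫ exp (i E t) f t dt`. -/
theorem lintegral_enorm_exp_integral_sq {f : ℝ → ℂ} (hf : Integrable f) (hf2 : MemLp f 2) :
    ∫⁻ E : ℝ, ‖∫ t : ℝ, Complex.exp (Complex.I * E * t) * f t‖ₑ ^ 2 =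
      ENNReal.ofReal (2 * Real.pi) * ∫⁻ t, ‖f t‖ₑ ^ 2 := by
  rw [← lintegral_enorm_fourier_sq hf hf2]
  have hm := Real.smul_map_volume_mul_left (a := -(2 * Real.pi)) (by have := Real.pi_pos; linarith)
  have hpos : |-(2 * Real.pi)| = 2 * Real.pi := by
    rw [abs_neg, abs_of_pos (by positivity)]
  rw [hpos] at hm
  have he : MeasurableEmbedding fun x : ℝ => -(2 * Real.pi) * x :=
    (Homeomorph.mulLeft₀ (-(2 * Real.pi))
      (by have := Real.pi_pos; linarith)).measurableEmbedding
  have hsub : ∀ G : ℝ → ℝ≥0∞, ∫⁻ E, G E =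
      ENNReal.ofReal (2 * Real.pi) * ∫⁻ ξ, G (-(2 * Real.pi) * ξ) := fun G => by
    rw [← he.lintegral_map, ← smul_eq_mul, ← lintegral_smul_measure, hm]
  rw [hsub]
  congr 1
  refine lintegral_congr fun ξ => ?_
  have e : ∫ t : ℝ, Complex.exp (Complex.I * (-(2 * Real.pi) * ξ : ℝ) * t) * f t =
      FourierTransform.fourier f ξ := by
    rw [Real.fourier_real_eq_integral_exp_smul]
    refine integral_congr_ae (Eventually.of_forall fun t => ?_)
    simp only [smul_eq_mul]
    congr 2
    push_cast
    ring
  rw [← e]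

/-! ### Transfer matrices and solutions at nearby complex energies -/

open scoped Matrix

theorem transferUp_mul_stepMatrix (V : ℤ → ℝ) (E : ℝ) (m : ℤ) (k : ℕ) :
    transferUp V E m k * stepMatrix V E m = transferUp V E (m - 1) (k + 1) := by
  induction k with
  | zero => simp [transferUp]
  | succ k ih =>
    rw [transferUp, mul_assoc, ih]
    conv_rhs => rw [transferUp]
    congr 2
    push_cast
    ring

theorem transfer_self (V : ℤ → ℝ) (E : ℝ) (n : ℤ) : transfer V E n n = 1 := by
  simp [transfer, transferUp]

/-- The cocycle property. -/
theorem transfer_mul_stepMatrix (V : ℤ → ℝ) (E : ℝ) (n m : ℤ) :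
    transfer V E n m * stepMatrix V E m = transfer V E n (m - 1) := by
  unfold transfer
  by_cases h : m ≤ n
  · rw [if_pos h, if_pos (by omega), transferUp_mul_stepMatrix]
    congr 1
    omega
  · have hS : IsUnit (stepMatrix V E m).det := by simp [stepMatrix, Matrix.det_fin_two]
    obtain ⟨k, hk⟩ : ∃ k : ℕ, m = n + (k + 1 : ℕ) := ⟨(m - n - 1).toNat, by omega⟩
    have e : (transferUp V E n (m - n).toNat)⁻¹ * stepMatrix V E m = (transferUp V E n k)⁻¹ := by
      rw [show (m - n).toNat = k + 1 by omega, transferUp, Matrix.mul_inv_rev, ← hk,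
        Matrix.nonsing_inv_mul_cancel_right _ _ hS]
    rw [if_neg h, e]
    split_ifs with h2
    · obtain rfl : k = 0 := by omega
      rw [show (n - (m - 1)).toNat = 0 by omega]
      simp [transferUp]
    · congr 2
      omega

/-- A real matrix acts on complex vectors with the same norm. -/
theorem norm_map_mulVec_le {ι : Type*} [Fintype ι] [DecidableEq ι] (A : Matrix ι ι ℝ)
    (x : ι → ℂ) :
    ‖WithLp.toLp 2 (A.map Complex.ofReal *ᵥ x)‖ ≤ ‖A‖ * ‖WithLp.toLp 2 x‖ := by
  refine le_of_sq_le_sq ?_ (by positivity)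
  have hsq : ∀ y : ι → ℂ, ‖WithLp.toLp 2 y‖ ^ 2 =
      ‖WithLp.toLp 2 (fun i => (y i).re)‖ ^ 2 + ‖WithLp.toLp 2 (fun i => (y i).im)‖ ^ 2 := by
    intro y
    simp only [EuclideanSpace.norm_sq_eq, ← Finset.sum_add_distrib, Complex.sq_norm,
      Complex.normSq_apply, Real.norm_eq_abs, sq_abs]
    refine Finset.sum_congr rfl fun i _ => ?_
    ring
  have hre : (fun i => ((A.map Complex.ofReal *ᵥ x) i).re) = A *ᵥ fun i => (x i).re := by
    funext i
    simp [Matrix.mulVec, dotProduct]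
  have him : (fun i => ((A.map Complex.ofReal *ᵥ x) i).im) = A *ᵥ fun i => (x i).im := by
    funext i
    simp [Matrix.mulVec, dotProduct]
  rw [hsq, hre, him, mul_pow, hsq x, mul_add, ← mul_pow, ← mul_pow]
  gcongr
  · exact Matrix.l2_opNorm_mulVec A (WithLp.toLp 2 fun i => (x i).re)
  · exact Matrix.l2_opNorm_mulVec A (WithLp.toLp 2 fun i => (x i).im)

/-- The state `(φ (k + 1), φ k)` of a sequence at `k`, on which the transfer matrices act. -/
def state (φ : ℤ → ℂ) (k : ℤ) : Fin 2 → ℂ := ![φ (k + 1), φ k]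

/-- The Euclidean norm of the state at `k`. -/
def stateNorm (φ : ℤ → ℂ) (k : ℤ) : ℝ := ‖WithLp.toLp 2 (state φ k)‖

theorem stateNorm_nonneg (φ : ℤ → ℂ) (k : ℤ) : 0 ≤ stateNorm φ k := norm_nonneg _

theorem stateNorm_sq (φ : ℤ → ℂ) (k : ℤ) :
    stateNorm φ k ^ 2 = ‖φ (k + 1)‖ ^ 2 + ‖φ k‖ ^ 2 := by
  simp [stateNorm, state, EuclideanSpace.norm_sq_eq]

theorem norm_le_stateNorm (φ : ℤ → ℂ) (k : ℤ) : ‖φ k‖ ≤ stateNorm φ k :=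
  le_of_sq_le_sq (by rw [stateNorm_sq]; nlinarith [sq_nonneg ‖φ (k + 1)‖]) (stateNorm_nonneg _ _)

theorem norm_succ_le_stateNorm (φ : ℤ → ℂ) (k : ℤ) : ‖φ (k + 1)‖ ≤ stateNorm φ k :=
  le_of_sq_le_sq (by rw [stateNorm_sq]; nlinarith [sq_nonneg ‖φ k‖]) (stateNorm_nonneg _ _)

/-- Variation of constants: a solution at the complex energy `z` solves the equation at the real
energy `E` with the source `(z - E) φ`. -/
theorem transfer_mulVec_state {V : ℤ → ℝ} {φ : ℤ → ℂ} {z : ℂ} (E : ℝ) (k a : ℤ) (M : ℕ)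
    (hφ : ∀ j : ℕ, j < M → φ (a + j + 1 + 1) + φ (a + j) + V (a + j + 1) * φ (a + j + 1) =
      z * φ (a + j + 1)) :
    (transfer V E k (a + M)).map Complex.ofReal *ᵥ state φ (a + M) =
      (transfer V E k a).map Complex.ofReal *ᵥ state φ a +
        ∑ j ∈ Finset.range M, (transfer V E k (a + j + 1)).map Complex.ofReal *ᵥ
          ![(z - E) * φ (a + j + 1), 0] := by
  induction M with
  | zero => simp
  | succ M ih =>
    rw [Finset.sum_range_succ, ← add_assoc, ← ih fun j hj => hφ j (by omega)]
    have hs : (transfer V E k (a + M)).map Complex.ofReal =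
        (transfer V E k (a + M + 1)).map Complex.ofReal *
          (stepMatrix V E (a + M + 1)).map Complex.ofReal := by
      have := transfer_mul_stepMatrix V E k (a + M + 1)
      rw [add_sub_cancel_right] at this
      rw [← this]
      exact Matrix.map_mul (f := Complex.ofRealHom)
    rw [hs, ← Matrix.mulVec_mulVec, ← Matrix.mulVec_add]
    push_cast
    rw [← add_assoc]
    congr 1
    have h := hφ M (by omega)
    ext i
    fin_cases i
    · simp [state, stepMatrix]
      linear_combination h
    · simp [state, stepMatrix]

/-- A discrete Gronwall inequality. -/
theorem le_of_le_add_sum {r : ℕ → ℝ} {c q : ℝ} (hq : 0 ≤ q) {M : ℕ}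
    (h : ∀ i ≤ M, r i ≤ c + q * ∑ j ∈ Finset.range i, r j) : r M ≤ c * (1 + q) ^ M := by
  have key : ∀ i ≤ M, c + q * ∑ j ∈ Finset.range i, r j ≤ c * (1 + q) ^ i := by
    intro i
    induction i with
    | zero => simp
    | succ i ih =>
      intro hi
      have h1 := ih (by omega)
      have h2 := mul_le_mul_of_nonneg_left ((h i (by omega)).trans h1) hq
      rw [Finset.sum_range_succ, pow_succ]
      linarith
  exact (h M le_rfl).trans (key M le_rfl)

section

variable {V : ℤ → ℝ} {φ : ℤ → ℂ} {z : ℂ} {E L δ : ℝ} {a : ℤ} {M : ℕ}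

theorem norm_source_le (hz : ‖z - E‖ ≤ δ) {k j : ℤ} (hL : ‖transfer V E k j‖ ≤ L) {s : ℝ}
    (hs : ‖φ j‖ ≤ s) :
    ‖WithLp.toLp 2 ((transfer V E k j).map Complex.ofReal *ᵥ ![(z - E) * φ j, 0])‖ ≤
      L * δ * s := by
  refine (norm_map_mulVec_le _ _).trans ?_
  have : ‖WithLp.toLp 2 ![(z - E) * φ j, 0]‖ = ‖z - E‖ * ‖φ j‖ := by
    simp [EuclideanSpace.norm_eq, Real.sqrt_sq (mul_nonneg (norm_nonneg _) (norm_nonneg _))]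
  rw [this, mul_assoc]
  have := (norm_nonneg _).trans hz
  gcongr
  exact (norm_nonneg _).trans hL

/-- If the transfer matrices at the real energy `E` are bounded by `L` on an interval, then a
solution at a complex energy `z` grows at most by the factor `L (1 + L |z - E|) ^ M` from the left
to the right end. -/
theorem stateNorm_right_le
    (hL : ∀ i ≤ M, ∀ j ≤ M, ‖transfer V E (a + i) (a + j)‖ ≤ L) (hz : ‖z - E‖ ≤ δ)
    (hφ : ∀ j : ℕ, j < M → φ (a + j + 1 + 1) + φ (a + j) + V (a + j + 1) * φ (a + j + 1) =
      z * φ (a + j + 1)) :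
    stateNorm φ (a + M) ≤ L * (1 + L * δ) ^ M * stateNorm φ a := by
  have hδ : 0 ≤ δ := (norm_nonneg _).trans hz
  have hL0 : 0 ≤ L := (norm_nonneg _).trans (hL 0 (by omega) 0 (by omega))
  rw [mul_right_comm]
  refine le_of_le_add_sum (r := fun i => stateNorm φ (a + i)) (mul_nonneg hL0 hδ) fun i hi => ?_
  have h := transfer_mulVec_state E (a + i) a i fun j hj => hφ j (hj.trans_le hi)
  rw [transfer_self, Matrix.map_one _ Complex.ofReal_zero Complex.ofReal_one,
    Matrix.one_mulVec] at h
  rw [stateNorm, h, WithLp.toLp_add, WithLp.toLp_sum]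
  refine (norm_add_le _ _).trans (add_le_add ?_ ((norm_sum_le _ _).trans ?_))
  · refine (norm_map_mulVec_le _ _).trans (mul_le_mul_of_nonneg_right ?_ (norm_nonneg _))
    simpa using hL i hi 0 (by omega)
  · rw [Finset.mul_sum]
    refine Finset.sum_le_sum fun j hj => ?_
    rw [Finset.mem_range] at hj
    refine norm_source_le hz ?_ (norm_succ_le_stateNorm _ _)
    have := hL i hi (j + 1) (by omega)
    push_cast at this
    rwa [← add_assoc] at this

/-- The counterpart of `stateNorm_right_le` from the right to the left end. -/
theorem stateNorm_left_le
    (hL : ∀ i ≤ M, ∀ j ≤ M, ‖transfer V E (a + i) (a + j)‖ ≤ L) (hz : ‖z - E‖ ≤ δ)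
    (hφ : ∀ j : ℕ, j < M → φ (a + j + 1 + 1) + φ (a + j) + V (a + j + 1) * φ (a + j + 1) =
      z * φ (a + j + 1)) :
    stateNorm φ a ≤ L * (1 + L * δ) ^ M * stateNorm φ (a + M) := by
  have hδ : 0 ≤ δ := (norm_nonneg _).trans hz
  have hL0 : 0 ≤ L := (norm_nonneg _).trans (hL 0 (by omega) 0 (by omega))
  rw [mul_right_comm]
  have key := le_of_le_add_sum (r := fun i => stateNorm φ (a + (M - i : ℕ))) (M := M)
    (c := L * stateNorm φ (a + M)) (mul_nonneg hL0 hδ) fun i hi => ?_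
  · simpa using key
  have h := transfer_mulVec_state E (a + (M - i : ℕ)) (a + (M - i : ℕ)) i fun j hj => by
    have := hφ (M - i + j) (by omega)
    rw [Nat.cast_add] at this
    simp only [← add_assoc] at this
    exact this
  rw [transfer_self, Matrix.map_one _ Complex.ofReal_zero Complex.ofReal_one,
    Matrix.one_mulVec] at h
  rw [show a + ((M - i : ℕ) : ℤ) + (i : ℤ) = a + M by omega] at h
  rw [stateNorm, eq_sub_of_add_eq h.symm, WithLp.toLp_sub, WithLp.toLp_sum]
  refine (norm_sub_le _ _).trans (add_le_add ?_ ((norm_sum_le _ _).trans ?_))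
  · refine (norm_map_mulVec_le _ _).trans (mul_le_mul_of_nonneg_right ?_ (norm_nonneg _))
    exact hL (M - i) (by omega) M le_rfl
  · rw [Finset.mul_sum, ← Finset.sum_range_reflect]
    refine Finset.sum_le_sum fun j hj => ?_
    rw [Finset.mem_range] at hj
    have e : a + ((M - i : ℕ) : ℤ) + ((i - 1 - j : ℕ) : ℤ) + 1 = a + (M - j : ℕ) := by omega
    rw [e]
    exact norm_source_le hz (hL _ (by omega) _ (by omega)) (norm_le_stateNorm _ _)

end

variable {Λ : Set ℤ} {V : ℤ → ℝ}

/-! ### The resolvent as a Laplace transform of the evolution -/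

theorem extendZero_coe (f : Λ → ℂ) (n : Λ) : extendZero f n = f n :=
  Subtype.val_injective.extend_apply _ _ _

theorem extendZero_of_notMem (f : Λ → ℂ) {n : ℤ} (hn : n ∉ Λ) : extendZero f n = 0 :=
  Function.extend_apply' _ _ _ fun ⟨a, ha⟩ => hn (ha ▸ a.2)

theorem inner_delta_eq_extendZero (n : ℤ) (f : Ell2 Λ) :
    inner ℂ (delta Λ n) f = extendZero f n := by
  by_cases hn : n ∈ Λ
  · rw [inner_delta hn]
    exact (extendZero_coe (f : Λ → ℂ) ⟨n, hn⟩).symm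
  · rw [extendZero_of_notMem _ hn, delta, dif_neg hn, inner_zero_left]

theorem norm_delta_le (n : ℤ) : ‖delta Λ n‖ ≤ 1 := by
  unfold delta
  split_ifs with h
  · simp [lp.norm_single]
  · simp

theorem norm_extendZero_le (f : Ell2 Λ) (n : ℤ) : ‖extendZero f n‖ ≤ ‖f‖ := by
  rw [← inner_delta_eq_extendZero]
  exact (norm_inner_le_norm _ _).trans
    (mul_le_of_le_one_left (norm_nonneg _) (norm_delta_le n))

theorem extendZero_delta (h1 : (1 : ℤ) ∈ Λ) (n : ℤ) :
    extendZero (delta Λ 1) n = if n = 1 then 1 else 0 := by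
  by_cases hn : n ∈ Λ
  · rw [← inner_delta_eq_extendZero, inner_delta hn, delta, dif_pos h1, lp.single_apply,
      Pi.single_apply]
    simp [Subtype.ext_iff]
  · rw [extendZero_of_notMem _ hn, if_neg]
    rintro rfl
    exact hn h1

theorem continuous_evolution (Λ : Set ℤ) (V : ℤ → ℝ) : Continuous (evolution Λ V) :=
  continuous_iff_continuousAt.2 fun t => by
    obtain ⟨_, h⟩ := (evolution_spec Λ V).2 t
    exact h.continuousAt

theorem im_inner_hamiltonian (u : (hamiltonian Λ V).domain) :
    (inner ℂ (u : Ell2 Λ) (hamiltonian Λ V u)).im = 0 := by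
  have hs := hamiltonian_symm V u u
  rw [← inner_conj_symm] at hs
  exact Complex.conj_eq_iff_im.1 hs

/-- The evolution is unitary. -/
theorem norm_evolution (Λ : Set ℤ) (V : ℤ → ℝ) (t : ℝ) : ‖evolution Λ V t‖ = ‖delta Λ 1‖ := by
  obtain ⟨h0, hd⟩ := evolution_spec Λ V
  have hder : ∀ t, HasDerivAt (fun s => ‖evolution Λ V s‖ ^ 2) 0 t := by
    intro t
    obtain ⟨h, d⟩ := hd t
    refine d.norm_sq.congr_deriv ?_
    have hre : ∀ x y : Ell2 Λ, inner ℝ x y = (inner ℂ x y).re := fun x y =>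
      (lp.hasSum_inner (𝕜 := ℝ) x y).unique
        ((lp.hasSum_inner (𝕜 := ℂ) x y).mapL Complex.reCLM)
    have him : (inner ℂ (evolution Λ V t) (hamiltonian Λ V ⟨evolution Λ V t, h⟩)).im = 0 :=
      im_inner_hamiltonian ⟨_, h⟩
    rw [hre, inner_smul_right]
    simp [him]
  have := is_const_of_deriv_eq_zero (fun s => (hder s).differentiableAt)
    (fun s => (hder s).deriv) t 0
  simp only [h0] at this
  exact (pow_left_inj₀ (norm_nonneg _) (norm_nonneg _) two_ne_zero).1 this

theorem hasDerivAt_extendZero_evolution (n : Λ) (t : ℝ) :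
    HasDerivAt (fun s => extendZero (evolution Λ V s) n)
      (-Complex.I * action V (evolution Λ V t) n) t := by
  obtain ⟨h, d⟩ := (evolution_spec Λ V).2 t
  have := (lp.evalCLM ℝ (fun _ : Λ => ℂ) 2 n).hasFDerivAt.comp_hasDerivAt t d
  simp only [extendZero_coe]
  exact this

theorem norm_cexp_laplace (z : ℂ) (t : ℝ) :
    ‖Complex.exp (Complex.I * z * t)‖ = Real.exp (-z.im * t) := by
  rw [Complex.norm_exp]
  simp

theorem integrableOn_laplace {E : Type*} [NormedAddCommGroup E] [NormedSpace ℂ E] {z : ℂ}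
    (hz : 0 < z.im) {g : ℝ → E} (hg : Continuous g) {C : ℝ} (hC : ∀ t, ‖g t‖ ≤ C) :
    IntegrableOn (fun t : ℝ => Complex.exp (Complex.I * z * t) • g t) (Set.Ioi 0) := by
  refine Integrable.mono' ((integrableOn_exp_mul_Ioi (neg_neg_of_pos hz) 0).mul_const C)
    (Continuous.aestronglyMeasurable (by fun_prop)) (Eventually.of_forall fun t => ?_)
  rw [norm_smul, norm_cexp_laplace]
  exact mul_le_mul_of_nonneg_left (hC t) (Real.exp_pos _).le

/-- The resolvent vector `(H - z)⁻¹ δ_1` for `0 < im z`, as the Laplace transform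
`i ∫_0^∞ exp (i z t) exp (-i t H) δ_1 dt`. -/
def resolventVec (Λ : Set ℤ) (V : ℤ → ℝ) (z : ℂ) : Ell2 Λ :=
  Complex.I • ∫ t in Set.Ioi (0 : ℝ), Complex.exp (Complex.I * z * t) • evolution Λ V t

/-- The Green function `⟨δ_n, (H - z)⁻¹ δ_1⟩`, extended by zero to all integers `n`. -/
def green (Λ : Set ℤ) (V : ℤ → ℝ) (z : ℂ) (n : ℤ) : ℂ := extendZero (resolventVec Λ V z) n

theorem norm_extendZero_evolution_le (n : ℤ) (t : ℝ) : ‖extendZero (evolution Λ V t) n‖ ≤ 1 :=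
  (norm_extendZero_le _ _).trans ((norm_evolution Λ V t).le.trans (norm_delta_le 1))

theorem continuous_extendZero_evolution (Λ : Set ℤ) (V : ℤ → ℝ) (n : ℤ) :
    Continuous fun t => extendZero (evolution Λ V t) n := by
  simp only [← inner_delta_eq_extendZero]
  exact continuous_const.inner (continuous_evolution Λ V)

theorem integrableOn_laplace_extendZero {z : ℂ} (hz : 0 < z.im) (n : ℤ) :
    IntegrableOn (fun t : ℝ => Complex.exp (Complex.I * z * t) *
      extendZero (evolution Λ V t) n) (Set.Ioi 0) :=
  integrableOn_laplace hz (continuous_extendZero_evolution Λ V n)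
    (norm_extendZero_evolution_le n)

theorem green_eq_integral {z : ℂ} (hz : 0 < z.im) (n : ℤ) : green Λ V z n =
    Complex.I * ∫ t in Set.Ioi (0 : ℝ), Complex.exp (Complex.I * z * t) *
      extendZero (evolution Λ V t) n := by
  rw [green, ← inner_delta_eq_extendZero, resolventVec, inner_smul_right]
  have h := (innerSL ℂ (delta Λ n)).integral_comp_comm
    (integrableOn_laplace hz (continuous_evolution Λ V) fun t => (norm_evolution Λ V t).le)
  simp only [innerSL_apply_apply, inner_smul_right, inner_delta_eq_extendZero] at h
  rw [inner_delta_eq_extendZero, h]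

/-- The resolvent equation `(H - z) u = δ_1`, by an integration by parts in time. -/
theorem green_equation (h1 : (1 : ℤ) ∈ Λ) {z : ℂ} (hz : 0 < z.im) {n : ℤ} (hn : n ∈ Λ) :
    green Λ V z (n + 1) + green Λ V z (n - 1) + V n * green Λ V z n =
      z * green Λ V z n + if n = 1 then 1 else 0 := by
  have hi := fun m => integrableOn_laplace_extendZero (Λ := Λ) (V := V) hz m
  have hder : ∀ t : ℝ, HasDerivAt (fun t : ℝ => Complex.exp (Complex.I * z * t) *
      extendZero (evolution Λ V t) n)
      (Complex.I * (z * (Complex.exp (Complex.I * z * t) * extendZero (evolution Λ V t) n) -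
        (Complex.exp (Complex.I * z * t) * extendZero (evolution Λ V t) (n + 1) +
        Complex.exp (Complex.I * z * t) * extendZero (evolution Λ V t) (n - 1) +
        V n * (Complex.exp (Complex.I * z * t) * extendZero (evolution Λ V t) n)))) t := by
    intro t
    have h : HasDerivAt (fun s : ℝ => Complex.I * z * s) (Complex.I * z) t := by
      simpa using (hasDerivAt_id t).ofReal_comp.const_mul (Complex.I * z)
    refine (h.cexp.mul (hasDerivAt_extendZero_evolution (V := V) ⟨n, hn⟩ t)).congr_deriv ?_
    rw [action, extendZero_coe (evolution Λ V t : Λ → ℂ) ⟨n, hn⟩]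
    ring
  have hlim : Tendsto (fun t : ℝ => Complex.exp (Complex.I * z * t) *
      extendZero (evolution Λ V t) n) atTop (𝓝 0) := by
    refine squeeze_zero_norm (a := fun t => Real.exp (-(z.im * t))) (fun t => ?_) ?_
    · rw [norm_mul, norm_cexp_laplace, neg_mul]
      exact mul_le_of_le_one_right (Real.exp_pos _).le (norm_extendZero_evolution_le n t)
    · exact Real.tendsto_exp_neg_atTop_nhds_zero.comp (tendsto_id.const_mul_atTop hz)
  have hI := integral_Ioi_of_hasDerivAt_of_tendsto' (a := 0) (fun t _ => hder t)
    ((((hi n).const_mul z).sub (((hi (n + 1)).add (hi (n - 1))).add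
      ((hi n).const_mul (V n : ℂ)))).const_mul Complex.I) hlim
  rw [integral_const_mul, integral_sub, integral_add, integral_add, integral_const_mul,
    integral_const_mul, (evolution_spec Λ V).1, extendZero_delta h1] at hI
  · simp only [green_eq_integral hz]
    simp only [Complex.ofReal_zero, mul_zero, Complex.exp_zero, one_mul, zero_sub] at hI
    linear_combination -hI
  · exact hi _
  · exact hi _
  · exact (hi _).add (hi _)
  · exact (hi _).const_mul _
  · exact (hi _).const_mul _
  · exact ((hi _).add (hi _)).add ((hi _).const_mul _)

theorem norm_ofReal_sub_ge {z : ℂ} (hz : 0 < z.im) (x : ℝ) : z.im ≤ ‖(x : ℂ) - z‖ := by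
  have := Complex.abs_im_le_norm ((x : ℂ) - z)
  simpa [abs_of_pos hz] using this

theorem integrable_cauchyKernel {z : ℂ} (hz : 0 < z.im) :
    Integrable (fun x : ℝ => 1 / ((x : ℂ) - z)) (spectralMeasure Λ V) := by
  have := (spectralMeasure_spec Λ V).1
  refine Integrable.mono' (integrable_const (1 / z.im)) ?_ (Eventually.of_forall fun x => ?_)
  · refine Continuous.aestronglyMeasurable (continuous_const.div (by fun_prop) fun x h => ?_)
    have := norm_ofReal_sub_ge hz x
    rw [h, norm_zero] at this
    linarith
  · rw [norm_div, norm_one]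
    exact one_div_le_one_div_of_le hz (norm_ofReal_sub_ge hz x)

theorem borelTransform_eq_green {z : ℂ} (hz : 0 < z.im) :
    borelTransform Λ V z = green Λ V z 1 := by
  obtain ⟨hfin, hμ⟩ := spectralMeasure_spec Λ V
  have hK : Integrable (Function.uncurry fun (t x : ℝ) =>
      Complex.exp (Complex.I * z * t) * Complex.exp (-Complex.I * t * x))
      ((volume.restrict (Set.Ioi 0)).prod (spectralMeasure Λ V)) := by
    refine Integrable.mono' ((integrableOn_exp_mul_Ioi (neg_neg_of_pos hz) 0).mul_prod
      (integrable_const (μ := spectralMeasure Λ V) (1 : ℝ)))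
      (Continuous.aestronglyMeasurable (by fun_prop)) (Eventually.of_forall fun p => ?_)
    have e : -Complex.I * p.1 * p.2 = ((-p.1 * p.2 : ℝ) : ℂ) * Complex.I := by
      push_cast; ring
    simp only [Function.uncurry]
    rw [norm_mul, norm_cexp_laplace, e, Complex.norm_exp_ofReal_mul_I]
  rw [green_eq_integral hz]
  have hin : ∀ t : ℝ, Complex.exp (Complex.I * z * t) * extendZero (evolution Λ V t) 1 =
      ∫ x : ℝ, Complex.exp (Complex.I * z * t) * Complex.exp (-Complex.I * t * x)
        ∂(spectralMeasure Λ V) := fun t => by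
    rw [integral_const_mul, hμ, inner_delta_eq_extendZero]
  simp only [hin]
  rw [integral_integral_swap hK, ← integral_const_mul, borelTransform]
  refine integral_congr_ae (Eventually.of_forall fun x => ?_)
  have hne : (x : ℂ) - z ≠ 0 := fun h => by
    have := norm_ofReal_sub_ge hz x
    rw [h, norm_zero] at this
    linarith
  have e : ∀ t : ℝ, Complex.exp (Complex.I * z * t) * Complex.exp (-Complex.I * t * x) =
      Complex.exp (-Complex.I * (x - z) * t) := fun t => by
    rw [← Complex.exp_add]
    congr 1
    ring
  simp only [e]
  rw [integral_exp_mul_complex_Ioi (by simpa using hz)]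
  simp only [Complex.ofReal_zero, mul_zero, Complex.exp_zero]
  field_simp

/-- Parseval's identity for the time average: `a(n,T)` is the integral of the squared Green
function at height `1 / T` over all energies. -/
theorem ofReal_avgProb (n : ℤ) {T : ℝ} (hT : 0 < T) : ENNReal.ofReal (avgProb Λ V n T) =
    ENNReal.ofReal (1 / (2 * Real.pi * T)) *
      ∫⁻ E : ℝ, ENNReal.ofReal (‖green Λ V ((E : ℂ) + ((1 / T : ℝ) : ℂ) * Complex.I) n‖ ^ 2) := by
  set f : ℝ → ℂ := (Set.Ioi 0).indicator fun t =>
    (Real.exp (-t / T) : ℂ) * extendZero (evolution Λ V t) n with hf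
  have hbd : ∀ t, ‖f t‖ ≤ (Set.Ioi 0).indicator (fun t => Real.exp (-(1 / T) * t)) t := fun t => by
    rw [hf, norm_indicator_eq_indicator_norm]
    refine Set.indicator_le_indicator ?_
    rw [norm_mul, Complex.norm_real, Real.norm_of_nonneg (Real.exp_pos _).le,
      show -(1 / T) * t = -t / T by ring]
    exact mul_le_of_le_one_right (Real.exp_pos _).le (norm_extendZero_evolution_le n t)
  have hmeas : AEStronglyMeasurable f := by
    refine (Continuous.aestronglyMeasurable ?_).indicator measurableSet_Ioi
    exact Continuous.mul (by fun_prop) (continuous_extendZero_evolution Λ V n)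
  have hsq : ∀ t, ‖f t‖ ^ 2 = (Set.Ioi 0).indicator (fun t => Real.exp (-2 * t / T) *
      ‖inner ℂ (delta Λ n) (evolution Λ V t)‖ ^ 2) t := fun t => by
    by_cases ht : t ∈ Set.Ioi (0 : ℝ)
    · rw [hf, Set.indicator_of_mem ht, Set.indicator_of_mem ht, norm_mul, Complex.norm_real,
        Real.norm_of_nonneg (Real.exp_pos _).le, mul_pow, ← Real.exp_nat_mul,
        inner_delta_eq_extendZero]
      congr 2
      push_cast
      ring
    · rw [hf, Set.indicator_of_notMem ht, Set.indicator_of_notMem ht]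
      simp
  have hneg : ∀ {b : ℝ}, 0 < b → -b / T < 0 := fun hb => div_neg_of_neg_of_pos (by linarith) hT
  have hint : Integrable f := by
    refine Integrable.mono' ((integrable_indicator_iff measurableSet_Ioi).2
      (integrableOn_exp_mul_Ioi ?_ 0)) hmeas (Eventually.of_forall hbd)
    have := one_div_pos.2 hT
    linarith
  have hint2 : Integrable fun t => ‖f t‖ ^ 2 := by
    refine Integrable.mono' ((integrable_indicator_iff measurableSet_Ioi).2
      (integrableOn_exp_mul_Ioi (hneg two_pos) 0)) (hmeas.norm.pow 2)
      (Eventually.of_forall fun t => ?_)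
    rw [Real.norm_of_nonneg (by positivity), hsq]
    refine Set.indicator_le_indicator ?_
    rw [inner_delta_eq_extendZero, show -2 / T * t = -2 * t / T by ring]
    exact mul_le_of_le_one_right (Real.exp_pos _).le
      (pow_le_one₀ (norm_nonneg _) (norm_extendZero_evolution_le n t))
  have hmem : MemLp f 2 := (memLp_two_iff_integrable_sq_norm hmeas).2 hint2
  have hgreen : ∀ E : ℝ, ENNReal.ofReal
      (‖green Λ V ((E : ℂ) + ((1 / T : ℝ) : ℂ) * Complex.I) n‖ ^ 2) =
      ‖∫ t : ℝ, Complex.exp (Complex.I * E * t) * f t‖ₑ ^ 2 := fun E => by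
    rw [green_eq_integral (by simpa using hT), norm_mul, Complex.norm_I, one_mul,
      ENNReal.ofReal_pow (norm_nonneg _), ofReal_norm, ← integral_indicator measurableSet_Ioi]
    congr 3
    funext t
    by_cases ht : t ∈ Set.Ioi (0 : ℝ)
    · rw [hf, Set.indicator_of_mem ht, Set.indicator_of_mem ht, ← mul_assoc, Complex.ofReal_exp,
        ← Complex.exp_add]
      congr 2
      push_cast
      linear_combination (1 / T * t : ℂ) * Complex.I_mul_I
    · rw [hf, Set.indicator_of_notMem ht, Set.indicator_of_notMem ht, mul_zero]
  have hlhs : avgProb Λ V n T = 1 / T * ∫ t, ‖f t‖ ^ 2 := by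
    simp only [hsq]
    rw [integral_indicator measurableSet_Ioi, avgProb]
  simp only [hgreen]
  rw [lintegral_enorm_exp_integral_sq hint hmem, hlhs, ENNReal.ofReal_mul (by positivity),
    ofReal_integral_eq_lintegral_ofReal hint2 (Eventually.of_forall fun t => by positivity),
    ← mul_assoc, ← ENNReal.ofReal_mul (by positivity)]
  congr 1
  · congr 1
    have := Real.pi_pos
    field_simp
  · refine lintegral_congr fun t => ?_
    rw [ENNReal.ofReal_pow (norm_nonneg _), ofReal_norm]

theorem measurable_green (n : ℤ) {ε : ℝ} (hε : 0 < ε) :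
    Measurable fun E : ℝ => green Λ V ((E : ℂ) + (ε : ℂ) * Complex.I) n := by
  have him : ∀ E : ℝ, ((E : ℂ) + (ε : ℂ) * Complex.I).im = ε := fun E => by simp
  simp only [fun E : ℝ => green_eq_integral (Λ := Λ) (V := V) (n := n) ((him E).symm ▸ hε)]
  refine Measurable.const_mul ?_ _
  refine StronglyMeasurable.measurable (StronglyMeasurable.integral_prod_right
    (f := fun (E t : ℝ) => Complex.exp (Complex.I * ((E : ℂ) + (ε : ℂ) * Complex.I) * t) *
      extendZero (evolution Λ V t) n) (Continuous.stronglyMeasurable ?_))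
  have := (continuous_extendZero_evolution Λ V n).comp (continuous_snd (X := ℝ))
  exact Continuous.mul (by fun_prop) this

/-! ### The imaginary part of the Borel transform -/

theorem im_cauchyKernel (x E ε : ℝ) :
    (1 / ((x : ℂ) - ((E : ℂ) + (ε : ℂ) * Complex.I))).im = ε / ((x - E) ^ 2 + ε ^ 2) := by
  rw [one_div, Complex.inv_im, Complex.normSq_apply]
  simp
  ring

theorem im_borelTransform (E : ℝ) {ε : ℝ} (hε : 0 < ε) :
    (borelTransform Λ V ((E : ℂ) + (ε : ℂ) * Complex.I)).im =
      ∫ x, ε / ((x - E) ^ 2 + ε ^ 2) ∂(spectralMeasure Λ V) := by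
  have hint := integrable_cauchyKernel (Λ := Λ) (V := V)
    (z := (E : ℂ) + (ε : ℂ) * Complex.I) (by simpa using hε)
  have := Complex.imCLM.integral_comp_comm hint
  simp only [Complex.imCLM_apply, im_cauchyKernel] at this
  exact this.symm

/-- The resolvent vector as an element of the domain. -/
theorem exists_hamiltonian_resolventVec (h1 : (1 : ℤ) ∈ Λ) {z : ℂ} (hz : 0 < z.im) :
    ∃ g : (hamiltonian Λ V).domain, (g : Ell2 Λ) = resolventVec Λ V z ∧
      hamiltonian Λ V g = z • (g : Ell2 Λ) + delta Λ 1 := by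
  have h : action V (resolventVec Λ V z) = (z • resolventVec Λ V z + delta Λ 1 : Ell2 Λ) := by
    funext n
    have := green_equation (V := V) h1 hz n.2
    rw [← extendZero_delta h1] at this
    simp only [green, extendZero_coe] at this
    exact this
  have hmem : resolventVec Λ V z ∈ (hamiltonian Λ V).domain := by
    show Memℓp (action V (resolventVec Λ V z)) 2
    rw [h]
    exact lp.memℓp _
  exact ⟨⟨_, hmem⟩, rfl, lp.ext h⟩

/-- At an eigenvalue `E₀` whose eigenvector `u` does not vanish at `1`, the imaginary part of the
Borel transform is bounded below by that of the point mass `|u 1|² / ‖u‖²` at `E₀`: it equals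
`im z * ‖(H - z)⁻¹ δ_1‖²`, and `(E₀ - z) ⟨u, (H - z)⁻¹ δ_1⟩` is the conjugate of `u 1`. -/
theorem im_borelTransform_ge_of_eigenvector (h1 : (1 : ℤ) ∈ Λ) {E₀ : ℝ}
    (u : (hamiltonian Λ V).domain) (hu : hamiltonian Λ V u = (E₀ : ℂ) • (u : Ell2 Λ))
    {z : ℂ} (hz : 0 < z.im) :
    z.im * ‖extendZero (u : Ell2 Λ) 1‖ ^ 2 ≤
      ‖(E₀ : ℂ) - z‖ ^ 2 * ‖(u : Ell2 Λ)‖ ^ 2 * (borelTransform Λ V z).im := by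
  obtain ⟨g, hg, hHg⟩ := exists_hamiltonian_resolventVec (V := V) h1 hz
  have him : (borelTransform Λ V z).im = z.im * ‖(g : Ell2 Λ)‖ ^ 2 := by
    have h := im_inner_hamiltonian g
    rw [hHg, inner_add_right, inner_smul_right, inner_self_eq_norm_sq_to_K,
      ← inner_conj_symm, inner_delta_eq_extendZero] at h
    rw [borelTransform_eq_green hz, green, ← hg]
    simp [← Complex.ofReal_pow] at h
    linarith
  have hpair : extendZero (u : Ell2 Λ) 1 = ((E₀ : ℂ) - starRingEnd ℂ z) *
      inner ℂ (g : Ell2 Λ) (u : Ell2 Λ) := by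
    have h := hamiltonian_symm V g u
    rw [hHg, hu, inner_add_left, inner_smul_left, inner_smul_right, inner_delta_eq_extendZero] at h
    linear_combination h
  have hn : ‖(E₀ : ℂ) - starRingEnd ℂ z‖ = ‖(E₀ : ℂ) - z‖ := by
    rw [← Complex.norm_conj]
    simp
  rw [him, hpair, norm_mul, hn, mul_pow]
  have hcs := norm_inner_le_norm (𝕜 := ℂ) (g : Ell2 Λ) (u : Ell2 Λ)
  calc z.im * (‖(E₀ : ℂ) - z‖ ^ 2 * ‖inner ℂ (g : Ell2 Λ) (u : Ell2 Λ)‖ ^ 2)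
      ≤ z.im * (‖(E₀ : ℂ) - z‖ ^ 2 * (‖(g : Ell2 Λ)‖ * ‖(u : Ell2 Λ)‖) ^ 2) := by gcongr
    _ = _ := by ring

/-! ### Lower bounds for the Green function away from the origin -/

/-- The resolvent equation at the site `1`. On the half-line `green Λ V z 0 = 0`. -/
theorem green_source (h1 : (1 : ℤ) ∈ Λ) {z : ℂ} (hz : 0 < z.im) {Z : ℝ}
    (hZ : ‖z‖ + |V 1| ≤ Z) :
    1 + ‖green Λ V z 1‖ ^ 2 ≤ (3 * Z ^ 2 + 3) *
      (‖green Λ V z 2‖ ^ 2 + ‖green Λ V z 1‖ ^ 2 + ‖green Λ V z 0‖ ^ 2) := by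
  have h := green_equation (V := V) h1 hz h1
  norm_num at h
  have e : (1 : ℂ) = green Λ V z 2 + green Λ V z 0 + (V 1 - z) * green Λ V z 1 := by
    linear_combination -h
  have hn : 1 ≤ ‖green Λ V z 2‖ + ‖green Λ V z 0‖ + Z * ‖green Λ V z 1‖ := by
    have h2 := congrArg norm e
    rw [norm_one] at h2
    rw [h2]
    refine (norm_add_le _ _).trans (add_le_add (norm_add_le _ _) ?_)
    rw [norm_mul]
    gcongr
    refine (norm_sub_le _ _).trans ?_
    rw [Complex.norm_real, Real.norm_eq_abs, add_comm]
    exact hZ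
  set a := ‖green Λ V z 2‖
  set b := ‖green Λ V z 0‖
  set d := ‖green Λ V z 1‖
  have hsq : 1 ≤ (a + b + Z * d) ^ 2 := one_le_pow₀ hn
  nlinarith [sq_nonneg (a - b), sq_nonneg (a - Z * d), sq_nonneg (b - Z * d), sq_nonneg (Z * a),
    sq_nonneg (Z * b), sq_nonneg d]

theorem one_mem_of_line (hΛ : Λ = Set.univ ∨ Λ = Set.Ici 1) : (1 : ℤ) ∈ Λ := by
  rcases hΛ with rfl | rfl <;> simp

theorem mem_of_line (hΛ : Λ = Set.univ ∨ Λ = Set.Ici 1) {n : ℤ} (hn : 1 ≤ n) : n ∈ Λ := by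
  rcases hΛ with rfl | rfl <;> simp [hn]

theorem one_add_pow_le_exp {q B : ℝ} (hq : 0 ≤ q) {M : ℕ} (h : q * M ≤ B) :
    (1 + q) ^ M ≤ Real.exp B := by
  refine le_trans (pow_le_pow_left₀ (by linarith) (Real.add_one_le_exp q |>.trans' (by linarith)) M)
    ?_
  rw [← Real.exp_nat_mul]
  exact Real.exp_le_exp.2 (by linarith)

theorem sum_le_tsum_subtype (s : Set ℤ) (S : ℤ → ℝ≥0∞) (R : Finset ℤ) (k : ℤ)
    (h : ∀ n ∈ R, n + k ∈ s) : ∑ n ∈ R, S (n + k) ≤ ∑' n : s, S n := by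
  have e : ∑ n ∈ R, S (n + k) = ∑ n ∈ R.map (addRightEmbedding k), s.indicator S n := by
    rw [Finset.sum_map]
    refine Finset.sum_congr rfl fun n hn => ?_
    exact (Set.indicator_of_mem (h n hn) S).symm
  rw [e, tsum_subtype]
  exact ENNReal.sum_le_tsum _

/-- Each of the neighbouring pairs starting at a site of `R` carries at least `b`, and no site of
`s` lies in more than two of them. -/
theorem ofReal_card_mul_le (s : Set ℤ) (g : ℤ → ℂ) (R : Finset ℤ) {b r : ℝ} (hb : 0 ≤ b)
    (hr : r ≤ R.card) (h0 : ∀ n ∈ R, n ∈ s) (h1 : ∀ n ∈ R, n + 1 ∈ s)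
    (hg : ∀ n ∈ R, b ≤ stateNorm g n ^ 2) :
    ENNReal.ofReal (r * b) ≤ 2 * ∑' n : s, ENNReal.ofReal (‖g n‖ ^ 2) := by
  have e0 := sum_le_tsum_subtype s (fun n => ENNReal.ofReal (‖g n‖ ^ 2)) R 0 (by simpa using h0)
  have e1 := sum_le_tsum_subtype s (fun n => ENNReal.ofReal (‖g n‖ ^ 2)) R 1 h1
  rw [two_mul]
  refine le_trans ?_ (add_le_add e1 e0)
  rw [← Finset.sum_add_distrib]
  calc ENNReal.ofReal (r * b) ≤ ENNReal.ofReal (∑ n ∈ R, b) := by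
        rw [Finset.sum_const, nsmul_eq_mul]
        gcongr
    _ = ∑ n ∈ R, ENNReal.ofReal b := ENNReal.ofReal_sum_of_nonneg fun _ _ => hb
    _ ≤ _ := by
        refine Finset.sum_le_sum fun n hn => ?_
        rw [add_zero, ← ENNReal.ofReal_add (by positivity) (by positivity), ← stateNorm_sq]
        exact ENNReal.ofReal_le_ofReal (hg n hn)

section

variable {E N L δ B : ℝ} {z : ℂ}

theorem stateNorm_one_le (hΛ : Λ = Set.univ ∨ Λ = Set.Ici 1)
    (hT : ∀ n ∈ Λ, ∀ m ∈ Λ, |(n : ℝ)| ≤ N → |(m : ℝ)| ≤ N → ‖transfer V E n m‖ ≤ L)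
    (hz0 : 0 < z.im) (hz : ‖z - E‖ ≤ δ) (hB : L * δ * N ≤ B) {n : ℤ} (hn : 1 ≤ n)
    (hnN : (n : ℝ) ≤ N) :
    stateNorm (green Λ V z) 1 ≤ L * Real.exp B * stateNorm (green Λ V z) n := by
  have hδ : 0 ≤ δ := (norm_nonneg _).trans hz
  obtain ⟨M, rfl⟩ : ∃ M : ℕ, n = 1 + M := ⟨(n - 1).toNat, by omega⟩
  push_cast at hnN
  have hL : ∀ i ≤ M, ∀ j ≤ M, ‖transfer V E (1 + i) (1 + j)‖ ≤ L := fun i hi j hj => by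
    have hi' : (i : ℝ) ≤ M := by exact_mod_cast hi
    have hj' : (j : ℝ) ≤ M := by exact_mod_cast hj
    refine hT _ (mem_of_line hΛ (by omega)) _ (mem_of_line hΛ (by omega)) ?_ ?_
    · push_cast
      rw [abs_of_nonneg (by positivity)]
      linarith
    · push_cast
      rw [abs_of_nonneg (by positivity)]
      linarith
  have hL0 : 0 ≤ L := (norm_nonneg _).trans (hL 0 (by omega) 0 (by omega))
  refine (stateNorm_left_le hL hz fun j hj => ?_).trans ?_
  · have := green_equation (V := V) (one_mem_of_line hΛ) hz0
      (mem_of_line hΛ (n := 1 + j + 1) (by omega))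
    rw [if_neg (by omega), add_zero, add_sub_cancel_right] at this
    exact this
  · gcongr
    · exact stateNorm_nonneg _ _
    · refine one_add_pow_le_exp (by positivity) (le_trans ?_ hB)
      gcongr
      linarith

theorem stateNorm_zero_le
    (hT : ∀ n m : ℤ, |(n : ℝ)| ≤ N → |(m : ℝ)| ≤ N → ‖transfer V E n m‖ ≤ L)
    (hz0 : 0 < z.im) (hz : ‖z - E‖ ≤ δ) (hB : L * δ * N ≤ B) {n : ℤ} (hn : n ≤ 0)
    (hnN : -N ≤ (n : ℝ)) :
    stateNorm (green Set.univ V z) 0 ≤ L * Real.exp B * stateNorm (green Set.univ V z) n := by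
  have hδ : 0 ≤ δ := (norm_nonneg _).trans hz
  obtain ⟨M, hM⟩ : ∃ M : ℕ, n + M = 0 := ⟨(-n).toNat, by omega⟩
  have hM' : (n : ℝ) + M = 0 := by exact_mod_cast hM
  have hL : ∀ i ≤ M, ∀ j ≤ M, ‖transfer V E (n + i) (n + j)‖ ≤ L := fun i hi j hj => by
    have hi' : (i : ℝ) ≤ M := by exact_mod_cast hi
    have hj' : (j : ℝ) ≤ M := by exact_mod_cast hj
    have hi0 : (0 : ℝ) ≤ i := by positivity
    have hj0 : (0 : ℝ) ≤ j := by positivity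
    refine hT _ _ ?_ ?_
    · push_cast
      rw [abs_le]
      constructor <;> linarith
    · push_cast
      rw [abs_le]
      constructor <;> linarith
  have hL0 : 0 ≤ L := (norm_nonneg _).trans (hL 0 (by omega) 0 (by omega))
  rw [← hM]
  refine (stateNorm_right_le hL hz fun j hj => ?_).trans ?_
  · have := green_equation (V := V) (Set.mem_univ 1) hz0 (Set.mem_univ (n + j + 1))
    rw [if_neg (by omega), add_zero, add_sub_cancel_right] at this
    exact this
  · gcongr
    · exact stateNorm_nonneg _ _
    · refine one_add_pow_le_exp (by positivity) (le_trans ?_ hB)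
      gcongr
      linarith

/-- Power-law bounds for the transfer matrices up to the scale `N` at an energy close to `z` force
the Green function to be large at distances between `N / 2` and `N`. -/
theorem le_tsum_green {C α Z : ℝ} (hΛ : Λ = Set.univ ∨ Λ = Set.Ici 1) (hN : 8 ≤ N) (hC : 0 < C)
    (hT : ∀ n ∈ Λ, ∀ m ∈ Λ, |(n : ℝ)| ≤ N → |(m : ℝ)| ≤ N → ‖transfer V E n m‖ ≤ C * N ^ α)
    (hz0 : 0 < z.im) (hz : ‖z - E‖ ≤ δ) (hB : C * N ^ α * δ * N ≤ B) (hZ : ‖z‖ + |V 1| ≤ Z) :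
    ENNReal.ofReal ((16 * (C * Real.exp B) ^ 2 * (3 * Z ^ 2 + 3))⁻¹ * N ^ (1 - 2 * α) *
        (1 + ‖borelTransform Λ V z‖ ^ 2)) ≤
      ∑' n : {n : ℤ // N / 2 ≤ |(n : ℝ)|}, ENNReal.ofReal (‖green Λ V z n‖ ^ 2) := by
  set g := green Λ V z with hg
  set D : ℝ := C * N ^ α * Real.exp B with hD
  have hN0 : 0 < N := by linarith
  have hDpos : 0 < D := by positivity
  set S : ℝ≥0∞ := ∑' n : {n : ℤ // N / 2 ≤ |(n : ℝ)|}, ENNReal.ofReal (‖g n‖ ^ 2) with hS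
  have hfl := Int.floor_le N
  have hfl' := Int.lt_floor_add_one N
  have hce := Int.le_ceil (N / 2)
  have hce' := Int.ceil_lt_add_one (N / 2)
  have hce1 : 1 ≤ ⌈N / 2⌉ := Int.one_le_ceil_iff.2 (by linarith)
  have hright : ENNReal.ofReal (N / 4 * (stateNorm g 1 ^ 2 / D ^ 2)) ≤ 2 * S := by
    refine ofReal_card_mul_le {n : ℤ | N / 2 ≤ |(n : ℝ)|} g (Finset.Icc ⌈N / 2⌉ ⌊N⌋) (by positivity)
      ?_ (fun n hn => ?_) (fun n hn => ?_) fun n hn => ?_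
    · rw [Int.card_Icc]
      have h : ((⌊N⌋ + 1 - ⌈N / 2⌉ : ℤ) : ℝ) ≤ ((⌊N⌋ + 1 - ⌈N / 2⌉).toNat : ℝ) := by
        exact_mod_cast Int.self_le_toNat _
      refine le_trans ?_ h
      push_cast
      linarith
    · rw [Finset.mem_Icc] at hn
      exact (Int.ceil_le.1 hn.1).trans (le_abs_self _)
    · rw [Finset.mem_Icc] at hn
      have := Int.ceil_le.1 hn.1
      refine le_trans ?_ (le_abs_self ((n + 1 : ℤ) : ℝ))
      push_cast
      linarith
    · rw [Finset.mem_Icc] at hn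
      have h := stateNorm_one_le hΛ hT hz0 hz hB (hce1.trans hn.1) (Int.le_floor.1 hn.2)
      rw [div_le_iff₀ (by positivity), mul_comm, ← mul_pow]
      exact pow_le_pow_left₀ (stateNorm_nonneg _ _) h 2
  have hleft : Λ = Set.univ → ENNReal.ofReal (N / 4 * (stateNorm g 0 ^ 2 / D ^ 2)) ≤ 2 * S := by
    intro hu
    subst hu
    refine ofReal_card_mul_le {n : ℤ | N / 2 ≤ |(n : ℝ)|} g
      (Finset.Icc (-⌊N⌋) (-⌈N / 2⌉ - 1)) (by positivity)
      ?_ (fun n hn => ?_) (fun n hn => ?_) fun n hn => ?_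
    · rw [Int.card_Icc]
      have h : ((-⌈N / 2⌉ - 1 + 1 - -⌊N⌋ : ℤ) : ℝ) ≤ ((-⌈N / 2⌉ - 1 + 1 - -⌊N⌋).toNat : ℝ) := by
        exact_mod_cast Int.self_le_toNat _
      refine le_trans ?_ h
      push_cast
      linarith
    · rw [Finset.mem_Icc] at hn
      have h : (n : ℝ) ≤ -⌈N / 2⌉ - 1 := by exact_mod_cast hn.2
      exact le_trans (by linarith) (neg_le_abs (n : ℝ))
    · rw [Finset.mem_Icc] at hn
      have h : (n : ℝ) ≤ -⌈N / 2⌉ - 1 := by exact_mod_cast hn.2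
      refine le_trans ?_ (neg_le_abs ((n + 1 : ℤ) : ℝ))
      push_cast
      linarith
    · rw [Finset.mem_Icc] at hn
      have h : (-⌊N⌋ : ℝ) ≤ n := by exact_mod_cast hn.1
      have h := stateNorm_zero_le (fun n m => hT n trivial m trivial) hz0 hz hB (n := n) (by omega)
        (by linarith)
      rw [div_le_iff₀ (by positivity), mul_comm, ← mul_pow]
      exact pow_le_pow_left₀ (stateNorm_nonneg _ _) h 2
  -- the three values around the source control `1 + |F z|²`
  have hboth : ENNReal.ofReal (N / 4 * ((‖g 2‖ ^ 2 + ‖g 1‖ ^ 2 + ‖g 0‖ ^ 2) / D ^ 2)) ≤ 4 * S := by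
    have s1 : stateNorm g 1 ^ 2 = ‖g 2‖ ^ 2 + ‖g 1‖ ^ 2 := stateNorm_sq g 1
    have s0 : stateNorm g 0 ^ 2 = ‖g 1‖ ^ 2 + ‖g 0‖ ^ 2 := stateNorm_sq g 0
    rw [show (4 : ℝ≥0∞) * S = 2 * S + 2 * S by ring]
    rcases hΛ with hΛ | hΛ
    · refine le_trans ?_ (add_le_add hright (hleft hΛ))
      rw [← ENNReal.ofReal_add (by positivity) (by positivity), ← mul_add, ← add_div, s1, s0]
      gcongr ENNReal.ofReal (N / 4 * (?_ / D ^ 2))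
      nlinarith [sq_nonneg ‖g 1‖]
    · have g0 : g 0 = 0 := extendZero_of_notMem _ (by simp [hΛ])
      refine le_trans ?_ (hright.trans le_self_add)
      rw [s1, g0]
      simp
  have hsrc := green_source (one_mem_of_line hΛ) hz0 hZ
  rw [borelTransform_eq_green hz0]
  have hpow : N ^ (1 - 2 * α) = N / (N ^ α) ^ 2 := by
    rw [Real.rpow_sub hN0, Real.rpow_one, mul_comm, Real.rpow_mul hN0.le, Real.rpow_two]
  have h4 : 4 * ENNReal.ofReal ((16 * (C * Real.exp B) ^ 2 * (3 * Z ^ 2 + 3))⁻¹ *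
      N ^ (1 - 2 * α) * (1 + ‖g 1‖ ^ 2)) ≤ 4 * S := by
    refine le_trans ?_ hboth
    rw [show (4 : ℝ≥0∞) = ENNReal.ofReal 4 by norm_num, ← ENNReal.ofReal_mul (by norm_num)]
    refine ENNReal.ofReal_le_ofReal ?_
    calc 4 * ((16 * (C * Real.exp B) ^ 2 * (3 * Z ^ 2 + 3))⁻¹ * N ^ (1 - 2 * α) *
          (1 + ‖g 1‖ ^ 2))
        ≤ 4 * ((16 * (C * Real.exp B) ^ 2 * (3 * Z ^ 2 + 3))⁻¹ * N ^ (1 - 2 * α) *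
          ((3 * Z ^ 2 + 3) * (‖g 2‖ ^ 2 + ‖g 1‖ ^ 2 + ‖g 0‖ ^ 2))) := by gcongr
      _ = _ := by
        rw [hpow, hD]
        have : 3 * Z ^ 2 + 3 ≠ 0 := by positivity
        field_simp
        ring
  exact (ENNReal.mul_le_mul_iff_right (by norm_num) (by norm_num)).1 h4

end

/-! ### Lower bounds for the time-averaged outside probabilities and moments -/

theorem tendsto_scale {α : ℝ} (hα : 0 ≤ α) : Tendsto (scale α) atTop atTop :=
  tendsto_rpow_atTop (by positivity)

theorem scale_rpow {α T : ℝ} (hT : 0 ≤ T) (s : ℝ) : scale α T ^ s = T ^ (s / (1 + α)) := by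
  rw [scale, ← Real.rpow_mul hT, one_div_mul_eq_div]

theorem avgProb_nonneg (n : ℤ) {T : ℝ} (hT : 0 < T) : 0 ≤ avgProb Λ V n T :=
  mul_nonneg (by positivity) (integral_nonneg fun t => by positivity)

/-- The estimate with `|F|²`, uniform in the set `A` of energies with power-law bounds. The radius
`3 / T` leaves room to replace the `2 / T`-neighbourhood of `A`, whose measurability is not
immediate, by its closure. -/
theorem exists_le_outsideProb (hΛ : Λ = Set.univ ∨ Λ = Set.Ici 1) (K C α : ℝ) (hC : 0 < C)
    (hα : 0 ≤ α) : ∃ c : ℝ, 0 < c ∧ ∀ᶠ T : ℝ in atTop, ∀ A : Set ℝ, A ⊆ Set.Icc (-K) K →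
      (∀ E ∈ A, ∀ n ∈ Λ, ∀ m ∈ Λ, |(n : ℝ)| ≤ scale α T → |(m : ℝ)| ≤ scale α T →
        ‖transfer V E n m‖ ≤ C * scale α T ^ α) →
      ∀ B : Set ℝ, MeasurableSet B → (∀ E ∈ B, ∃ E' ∈ A, |E - E'| ≤ 3 / T) →
        ENNReal.ofReal (c / T * scale α T ^ (1 - 2 * α)) * ∫⁻ E in B, ENNReal.ofReal
          (1 + ‖borelTransform Λ V ((E : ℂ) + ((1 / T : ℝ) : ℂ) * Complex.I)‖ ^ 2) ≤
          outsideProb Λ V (scale α T / 2) T := by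
  set Z : ℝ := K + 3 + 1 + |V 1|
  set c₀ : ℝ := (16 * (C * Real.exp (4 * C)) ^ 2 * (3 * Z ^ 2 + 3))⁻¹
  have hc₀ : 0 < c₀ := by positivity
  refine ⟨c₀ / (2 * Real.pi), by positivity, ?_⟩
  filter_upwards [eventually_ge_atTop 1, (tendsto_scale hα).eventually_ge_atTop 8] with T hT1 hN A hA
    hbd B hBm hB
  have hT : 0 < T := by linarith
  set N := scale α T
  have hN0 : 0 < N := by linarith
  -- the choice of `N` makes the bound `C N ^ α`, the length `N` and the energy shift `4 / T`
  -- multiply to the constant `4 C`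
  have hNT : N ^ α * N = T := by
    have h1 : (1 + α) / (1 + α) = 1 := div_self (by positivity)
    rw [mul_comm, ← Real.rpow_one_add' hN0.le (by positivity), scale_rpow hT.le, h1, Real.rpow_one]
  have hpt : ∀ E ∈ B, ENNReal.ofReal (c₀ * N ^ (1 - 2 * α)) * ENNReal.ofReal
      (1 + ‖borelTransform Λ V ((E : ℂ) + ((1 / T : ℝ) : ℂ) * Complex.I)‖ ^ 2) ≤
      ∑' n : {n : ℤ // N / 2 ≤ |(n : ℝ)|}, ENNReal.ofReal
        (‖green Λ V ((E : ℂ) + ((1 / T : ℝ) : ℂ) * Complex.I) n‖ ^ 2) := by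
    intro E hE
    obtain ⟨E', hE', hEE⟩ := hB E hE
    have hi : ‖((1 / T : ℝ) : ℂ) * Complex.I‖ = 1 / T := by
      rw [norm_mul, Complex.norm_I, mul_one, Complex.norm_real, Real.norm_of_nonneg (by positivity)]
    rw [← ENNReal.ofReal_mul (by positivity)]
    refine le_tsum_green (E := E') (δ := 4 / T) hΛ hN hC (hbd E' hE') (by simpa using hT) ?_ ?_ ?_
    · rw [add_sub_right_comm]
      refine (norm_add_le _ _).trans ?_
      rw [hi, ← Complex.ofReal_sub, Complex.norm_real, Real.norm_eq_abs]
      refine (add_le_add_left hEE _).trans (le_of_eq ?_)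
      ring
    · rw [show C * N ^ α * (4 / T) * N = C * (N ^ α * N) * (4 / T) by ring, hNT]
      refine le_of_eq ?_
      field_simp
    · have h1 : |E'| ≤ K := abs_le.2 (hA hE')
      have h2 : |E| ≤ |E'| + |E - E'| := by
        have := abs_add_le E' (E - E')
        rwa [add_sub_cancel] at this
      have h3 : 3 / T ≤ 3 := div_le_self (by norm_num) hT1
      have h4 : 1 / T ≤ 1 := div_le_self (by norm_num) hT1
      have h5 := norm_add_le (E : ℂ) (((1 / T : ℝ) : ℂ) * Complex.I)
      rw [hi, Complex.norm_real, Real.norm_eq_abs] at h5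
      simp only [Z]
      linarith
  calc ENNReal.ofReal (c₀ / (2 * Real.pi) / T * N ^ (1 - 2 * α)) * ∫⁻ E in B, ENNReal.ofReal
          (1 + ‖borelTransform Λ V ((E : ℂ) + ((1 / T : ℝ) : ℂ) * Complex.I)‖ ^ 2)
      = ENNReal.ofReal (1 / (2 * Real.pi * T)) * ∫⁻ E in B, ENNReal.ofReal (c₀ * N ^ (1 - 2 * α)) *
          ENNReal.ofReal
            (1 + ‖borelTransform Λ V ((E : ℂ) + ((1 / T : ℝ) : ℂ) * Complex.I)‖ ^ 2) := by
        rw [lintegral_const_mul' _ _ ENNReal.ofReal_ne_top, ← mul_assoc,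
          ← ENNReal.ofReal_mul (by positivity)]
        congr 2
        field_simp
    _ ≤ ENNReal.ofReal (1 / (2 * Real.pi * T)) * ∫⁻ E in B,
          ∑' n : {n : ℤ // N / 2 ≤ |(n : ℝ)|}, ENNReal.ofReal
            (‖green Λ V ((E : ℂ) + ((1 / T : ℝ) : ℂ) * Complex.I) n‖ ^ 2) := by
        gcongr 1
        exact setLIntegral_mono' hBm hpt
    _ ≤ ENNReal.ofReal (1 / (2 * Real.pi * T)) * ∫⁻ E : ℝ,
          ∑' n : {n : ℤ // N / 2 ≤ |(n : ℝ)|}, ENNReal.ofReal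
            (‖green Λ V ((E : ℂ) + ((1 / T : ℝ) : ℂ) * Complex.I) n‖ ^ 2) := by
        gcongr 1
        exact setLIntegral_le_lintegral _ _
    _ = outsideProb Λ V (N / 2) T := by
        have hm := fun n : {n : ℤ // N / 2 ≤ |(n : ℝ)|} => (((measurable_green (Λ := Λ) (V := V)
          (n : ℤ) (one_div_pos.2 hT)).norm.pow_const 2).ennreal_ofReal).aemeasurable (μ := volume)
        rw [lintegral_tsum hm, ← ENNReal.tsum_mul_left, outsideProb]
        exact tsum_congr fun n => (ofReal_avgProb _ hT).symm

theorem ofReal_mul_outsideProb_le_moment {p R T : ℝ} (hp : 0 ≤ p) (hR : 0 ≤ R) (hT : 0 < T) :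
    ENNReal.ofReal (R ^ p) * outsideProb Λ V R T ≤ moment Λ V p T := by
  rw [outsideProb, ← ENNReal.tsum_mul_left, moment]
  refine le_trans (ENNReal.tsum_le_tsum fun n => ?_) (ENNReal.tsum_comp_le_tsum_of_injective
    (f := fun n : {n : ℤ // R ≤ |(n : ℝ)|} => (n : ℤ)) Subtype.val_injective
    fun n : ℤ => ENNReal.ofReal (|(n : ℝ)| ^ p * avgProb Λ V n T))
  rw [← ENNReal.ofReal_mul (by positivity)]
  refine ENNReal.ofReal_le_ofReal (mul_le_mul_of_nonneg_right ?_ (avgProb_nonneg _ hT))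
  exact Real.rpow_le_rpow hR n.2 hp

theorem nbhd_subset_cthickening (A : Set ℝ) (r : ℝ) : nbhd A r ⊆ Metric.cthickening r A :=
  fun E ⟨E', hE', h⟩ => Metric.mem_cthickening_of_dist_le E E' r A hE' (by rwa [Real.dist_eq])

theorem exists_of_mem_cthickening {A : Set ℝ} {T E : ℝ} (hT : 0 < T)
    (hE : E ∈ Metric.cthickening (2 / T) A) : ∃ E' ∈ A, |E - E'| ≤ 3 / T := by
  have h : 2 / T < 3 / T := by gcongr; norm_num
  obtain ⟨E', hE', hd⟩ := Metric.mem_thickening_iff.1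
    (Metric.cthickening_subset_thickening' (by positivity) h A hE)
  exact ⟨E', hE', by rw [← Real.dist_eq]; exact hd.le⟩

/-- The Poisson kernel of width `ε`, without the factor `1 / π`, is at least `1 / (2 ε)` on an
interval of length `2 ε`. -/
theorem one_le_setLIntegral_poisson {ε x : ℝ} (hε : 0 < ε) {s : Set ℝ}
    (hs : Set.Icc (x - ε) (x + ε) ⊆ s) :
    1 ≤ ∫⁻ E in s, ENNReal.ofReal (ε / ((x - E) ^ 2 + ε ^ 2)) := by
  calc (1 : ℝ≥0∞) = ∫⁻ E in Set.Icc (x - ε) (x + ε), ENNReal.ofReal (1 / (2 * ε)) := by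
        rw [setLIntegral_const, Real.volume_Icc, ← ENNReal.ofReal_mul (by positivity),
          show 1 / (2 * ε) * (x + ε - (x - ε)) = 1 by field_simp; ring, ENNReal.ofReal_one]
    _ ≤ ∫⁻ E in Set.Icc (x - ε) (x + ε), ENNReal.ofReal (ε / ((x - E) ^ 2 + ε ^ 2)) := by
        refine setLIntegral_mono' measurableSet_Icc fun E hE => ENNReal.ofReal_le_ofReal ?_
        have h : (x - E) ^ 2 ≤ ε ^ 2 := sq_le_sq' (by linarith [hE.2]) (by linarith [hE.1])
        rw [div_le_div_iff₀ (by positivity) (by positivity)]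
        nlinarith
    _ ≤ _ := lintegral_mono_set hs

/-- The spectral measure of a set is bounded by the integral of `Im F` over a neighbourhood. -/
theorem spectralMeasure_cthickening_le (A : Set ℝ) {T : ℝ} (hT : 0 < T) :
    spectralMeasure Λ V (Metric.cthickening (1 / T) A) ≤
      ∫⁻ E in Metric.cthickening (2 / T) A, ENNReal.ofReal
        (borelTransform Λ V ((E : ℂ) + ((1 / T : ℝ) : ℂ) * Complex.I)).im := by
  have hfin := (spectralMeasure_spec Λ V).1
  have hε : 0 < 1 / T := one_div_pos.2 hT
  have hint : ∀ E : ℝ, Integrable (fun x => 1 / T / ((x - E) ^ 2 + (1 / T) ^ 2))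
      (spectralMeasure Λ V) := fun E => by
    simp only [← im_cauchyKernel]
    exact (integrable_cauchyKernel (z := (E : ℂ) + ((1 / T : ℝ) : ℂ) * Complex.I)
      (by simpa using hT)).im
  have hk : ∀ E : ℝ, ENNReal.ofReal
      (borelTransform Λ V ((E : ℂ) + ((1 / T : ℝ) : ℂ) * Complex.I)).im =
      ∫⁻ x, ENNReal.ofReal (1 / T / ((x - E) ^ 2 + (1 / T) ^ 2)) ∂(spectralMeasure Λ V) :=
    fun E => by
      rw [im_borelTransform E hε, ofReal_integral_eq_lintegral_ofReal (hint E)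
        (Eventually.of_forall fun x => by positivity)]
  have hmeas : Measurable (Function.uncurry fun (E x : ℝ) =>
      ENNReal.ofReal (1 / T / ((x - E) ^ 2 + (1 / T) ^ 2))) := by
    unfold Function.uncurry
    fun_prop
  simp only [hk]
  rw [lintegral_lintegral_swap hmeas.aemeasurable]
  calc spectralMeasure Λ V (Metric.cthickening (1 / T) A)
      = ∫⁻ _ in Metric.cthickening (1 / T) A, 1 ∂(spectralMeasure Λ V) := by
        rw [setLIntegral_one]
    _ ≤ ∫⁻ x in Metric.cthickening (1 / T) A, (∫⁻ E in Metric.cthickening (2 / T) A,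
          ENNReal.ofReal (1 / T / ((x - E) ^ 2 + (1 / T) ^ 2))) ∂(spectralMeasure Λ V) := by
        refine setLIntegral_mono' Metric.isClosed_cthickening.measurableSet fun x hx =>
          one_le_setLIntegral_poisson hε fun E hE => ?_
        have h := Metric.cthickening_cthickening_subset hε.le hε.le A
        rw [show 1 / T + 1 / T = 2 / T by ring] at h
        refine h (Metric.mem_cthickening_of_dist_le E x _ _ hx ?_)
        rw [Real.dist_eq, abs_le]
        constructor <;> linarith [hE.1, hE.2]
    _ ≤ _ := setLIntegral_le_lintegral _ _

theorem measure_add_le_lintegral (A : Set ℝ) {T : ℝ} (hT : 0 < T) :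
    ENNReal.ofReal (1 / 2 * (volume.real (nbhd A (1 / T)) +
        (spectralMeasure Λ V).real (nbhd A (1 / T)))) ≤
      ∫⁻ E in Metric.cthickening (2 / T) A, ENNReal.ofReal
        (1 + ‖borelTransform Λ V ((E : ℂ) + ((1 / T : ℝ) : ℂ) * Complex.I)‖ ^ 2) := by
  have h12 : (1 / T) ≤ 2 / T := by gcongr; norm_num
  have hvol : ENNReal.ofReal (volume.real (nbhd A (1 / T))) ≤
      ∫⁻ E in Metric.cthickening (2 / T) A, ENNReal.ofReal
        (1 + ‖borelTransform Λ V ((E : ℂ) + ((1 / T : ℝ) : ℂ) * Complex.I)‖ ^ 2) := by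
    calc ENNReal.ofReal (volume.real (nbhd A (1 / T))) ≤ volume (nbhd A (1 / T)) :=
          ENNReal.ofReal_toReal_le
      _ ≤ volume (Metric.cthickening (2 / T) A) := measure_mono
          ((nbhd_subset_cthickening A _).trans (Metric.cthickening_mono h12 A))
      _ = ∫⁻ _ in Metric.cthickening (2 / T) A, 1 := by rw [setLIntegral_one]
      _ ≤ _ := by
          refine lintegral_mono fun E => ?_
          rw [← ENNReal.ofReal_one]
          exact ENNReal.ofReal_le_ofReal (le_add_of_nonneg_right (by positivity))
  have hmu : ENNReal.ofReal ((spectralMeasure Λ V).real (nbhd A (1 / T))) ≤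
      ∫⁻ E in Metric.cthickening (2 / T) A, ENNReal.ofReal
        (1 + ‖borelTransform Λ V ((E : ℂ) + ((1 / T : ℝ) : ℂ) * Complex.I)‖ ^ 2) := by
    refine ENNReal.ofReal_toReal_le.trans ((measure_mono (nbhd_subset_cthickening A _)).trans
      ((spectralMeasure_cthickening_le A hT).trans (lintegral_mono fun E =>
        ENNReal.ofReal_le_ofReal ?_)))
    have := Complex.abs_im_le_norm (borelTransform Λ V ((E : ℂ) + ((1 / T : ℝ) : ℂ) * Complex.I))
    have := le_abs_self (borelTransform Λ V ((E : ℂ) + ((1 / T : ℝ) : ℂ) * Complex.I)).im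
    nlinarith [sq_nonneg
      (‖borelTransform Λ V ((E : ℂ) + ((1 / T : ℝ) : ℂ) * Complex.I)‖ - 1 / 2)]
  rcases le_total (volume.real (nbhd A (1 / T))) ((spectralMeasure Λ V).real (nbhd A (1 / T)))
    with h | h
  · exact (ENNReal.ofReal_le_ofReal (by linarith)).trans hmu
  · exact (ENNReal.ofReal_le_ofReal (by linarith)).trans hvol

theorem exists_le_outsideProb_measure (hΛ : Λ = Set.univ ∨ Λ = Set.Ici 1) (K C α : ℝ)
    (hC : 0 < C) (hα : 0 ≤ α) : ∃ c : ℝ, 0 < c ∧ ∀ᶠ T : ℝ in atTop, ∀ A : Set ℝ,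
      A ⊆ Set.Icc (-K) K →
      (∀ E ∈ A, ∀ n ∈ Λ, ∀ m ∈ Λ, |(n : ℝ)| ≤ scale α T → |(m : ℝ)| ≤ scale α T →
        ‖transfer V E n m‖ ≤ C * scale α T ^ α) →
      ENNReal.ofReal (c / T * scale α T ^ (1 - 2 * α) * (volume.real (nbhd A (1 / T)) +
        (spectralMeasure Λ V).real (nbhd A (1 / T)))) ≤
          outsideProb Λ V (scale α T / 2) T := by
  obtain ⟨c, hc, h⟩ := exists_le_outsideProb (V := V) hΛ K C α hC hα
  refine ⟨c / 2, by positivity, ?_⟩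
  filter_upwards [h, eventually_gt_atTop 0] with T h hT A hA hbd
  refine le_trans ?_ (h A hA hbd _ Metric.isClosed_cthickening.measurableSet
    fun E hE => exists_of_mem_cthickening hT hE)
  refine le_trans (le_of_eq ?_) (mul_le_mul_right (measure_add_le_lintegral A hT) _)
  have : 0 ≤ scale α T := Real.rpow_nonneg hT.le _
  rw [← ENNReal.ofReal_mul (by positivity)]
  congr 1
  ring

theorem half_rpow_mul_rpow {N p s : ℝ} (hN : 0 < N) :
    (N / 2) ^ p * N ^ s = (2 ^ p)⁻¹ * N ^ (p + s) := by
  rw [Real.div_rpow hN.le zero_le_two, Real.rpow_add hN]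
  ring

theorem exists_le_moment_measure (hΛ : Λ = Set.univ ∨ Λ = Set.Ici 1) (K C α : ℝ)
    (hC : 0 < C) (hα : 0 ≤ α) {p : ℝ} (hp : 0 ≤ p) : ∃ c : ℝ, 0 < c ∧ ∀ᶠ T : ℝ in atTop,
      ∀ A : Set ℝ, A ⊆ Set.Icc (-K) K →
      (∀ E ∈ A, ∀ n ∈ Λ, ∀ m ∈ Λ, |(n : ℝ)| ≤ scale α T → |(m : ℝ)| ≤ scale α T →
        ‖transfer V E n m‖ ≤ C * scale α T ^ α) →
      ENNReal.ofReal (c / T * scale α T ^ (p + 1 - 2 * α) * (volume.real (nbhd A (1 / T)) +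
        (spectralMeasure Λ V).real (nbhd A (1 / T)))) ≤ moment Λ V p T := by
  obtain ⟨c, hc, h⟩ := exists_le_outsideProb_measure (V := V) hΛ K C α hC hα
  refine ⟨c * (2 ^ p)⁻¹, by positivity, ?_⟩
  filter_upwards [h, eventually_gt_atTop 0] with T h hT A hA hbd
  have hN : 0 < scale α T := Real.rpow_pos_of_pos hT _
  refine le_trans ?_ (ofReal_mul_outsideProb_le_moment (R := scale α T / 2) hp (by positivity) hT)
  refine le_trans (le_of_eq ?_) (mul_le_mul_right (h A hA hbd) _)
  rw [← ENNReal.ofReal_mul (by positivity)]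
  congr 1
  have := half_rpow_mul_rpow (p := p) (s := 1 - 2 * α) hN
  rw [← add_sub_assoc] at this
  linear_combination -(c / T * (volume.real (nbhd A (1 / T)) +
        (spectralMeasure Λ V).real (nbhd A (1 / T)))) * this

/-! ### Growth exponents -/

theorem le_lowerExponent_of_eventually_le {p c γ : ℝ} (hc : 0 < c)
    (h : ∀ᶠ T : ℝ in atTop, ENNReal.ofReal (c * T ^ γ) ≤ moment Λ V p T) :
    ((γ : ℝ) : EReal) ≤ lowerExponent Λ V p := by
  have hlim : Tendsto (fun T : ℝ => ((Real.log c / Real.log T + γ : ℝ) : EReal)) atTop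
      (𝓝 (γ : EReal)) := by
    refine (continuous_coe_real_ereal.tendsto γ).comp ?_
    have := (Real.tendsto_log_atTop.const_div_atTop (Real.log c)).add_const γ
    rwa [zero_add] at this
  rw [← hlim.liminf_eq]
  refine liminf_le_liminf ?_
  filter_upwards [h, eventually_gt_atTop 1] with T hT hT1
  have hlog : 0 < Real.log T := Real.log_pos hT1
  have hpos : 0 < T ^ γ := Real.rpow_pos_of_pos (by linarith) _
  have e : ((Real.log c / Real.log T + γ : ℝ) : EReal) =
      ENNReal.log (ENNReal.ofReal (c * T ^ γ)) / ((Real.log T : ℝ) : EReal) := by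
    rw [ENNReal.log_ofReal_of_pos (by positivity), ← EReal.coe_div]
    congr 1
    rw [Real.log_mul hc.ne' hpos.ne', Real.log_rpow (by linarith)]
    field_simp
  rw [e]
  exact EReal.div_le_div_right_of_nonneg (by exact_mod_cast hlog.le) (ENNReal.log_le_log_iff.2 hT)

/-! ### Power-law bounds at fixed energies -/

theorem inv_mul_scale_rpow {α T : ℝ} (hα : 0 ≤ α) (hT : 0 < T) (p : ℝ) :
    T⁻¹ * scale α T ^ (p + 1 - 2 * α) = T ^ ((p - 3 * α) / (1 + α)) := by
  rw [scale_rpow hT.le, ← Real.rpow_neg_one, ← Real.rpow_add hT]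
  congr 1
  have : 1 + α ≠ 0 := by positivity
  field_simp
  ring

/-- For `(n, m) = (0, 0)`, where nothing is assumed, the transfer matrix is the identity. -/
theorem norm_transfer_le {E C α N : ℝ} (hα : 0 ≤ α)
    (h : ∀ n ∈ Λ, ∀ m ∈ Λ, (n, m) ≠ (0, 0) →
      ‖transfer V E n m‖ ≤ C * (|(n : ℝ)| ^ α + |(m : ℝ)| ^ α)) (hN : 1 ≤ N) :
    ∀ n ∈ Λ, ∀ m ∈ Λ, |(n : ℝ)| ≤ N → |(m : ℝ)| ≤ N →
      ‖transfer V E n m‖ ≤ (2 * |C| + 1) * N ^ α := by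
  intro n hn m hm hnN hmN
  have hN1 : 1 ≤ N ^ α := Real.one_le_rpow hN hα
  by_cases h0 : (n, m) = (0, 0)
  · obtain ⟨rfl, rfl⟩ := Prod.mk.inj h0
    rw [transfer_self, CStarRing.norm_one]
    nlinarith [abs_nonneg C]
  · have h1 := Real.rpow_le_rpow (abs_nonneg _) hnN hα
    have h2 := Real.rpow_le_rpow (abs_nonneg _) hmN hα
    calc ‖transfer V E n m‖ ≤ C * (|(n : ℝ)| ^ α + |(m : ℝ)| ^ α) := h n hn m hm h0
      _ ≤ |C| * (N ^ α + N ^ α) := by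
        gcongr
        exact le_abs_self C
      _ ≤ _ := by linarith

/-- Without integrability the left-hand side is zero. -/
theorem ofReal_integral_le_lintegral {μ : Measure ℝ} {f : ℝ → ℝ} (hf : ∀ x, 0 ≤ f x) :
    ENNReal.ofReal (∫ x, f x ∂μ) ≤ ∫⁻ x, ENNReal.ofReal (f x) ∂μ := by
  by_cases h : Integrable f μ
  · rw [ofReal_integral_eq_lintegral_ofReal h (Eventually.of_forall hf)]
  · rw [integral_undef h]
    simp

theorem nbhd_singleton (E r : ℝ) : nbhd {E} r = Set.Icc (E - r) (E + r) := by
  ext x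
  simp only [nbhd, Set.mem_ofPred_eq, Set.mem_singleton_iff, exists_eq_left, Set.mem_Icc, abs_le]
  constructor <;> rintro ⟨h1, h2⟩ <;> constructor <;> linarith

/-! ### Eigenvalues -/

section

variable {E₀ C α : ℝ} {u : (hamiltonian Λ V).domain}

theorem eigenvector_equation (hu : hamiltonian Λ V u = (E₀ : ℂ) • (u : Ell2 Λ)) {n : ℤ}
    (hn : n ∈ Λ) : extendZero (u : Ell2 Λ) (n + 1) + extendZero (u : Ell2 Λ) (n - 1) +
      V n * extendZero (u : Ell2 Λ) n = E₀ * extendZero (u : Ell2 Λ) n := by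
  have h := congrFun (congrArg (fun f : Ell2 Λ => (f : Λ → ℂ)) hu) ⟨n, hn⟩
  simp only [extendZero_coe (u : Ell2 Λ) ⟨n, hn⟩]
  exact h

/-- To the right, an eigenvector decays at most like `n ^ (-α)` and grows at most like `n ^ α`. -/
theorem eigenvector_state_one_le (hΛ : Λ = Set.univ ∨ Λ = Set.Ici 1) (hα : 0 ≤ α)
    (h : ∀ n ∈ Λ, ∀ m ∈ Λ, (n, m) ≠ (0, 0) →
      ‖transfer V E₀ n m‖ ≤ C * (|(n : ℝ)| ^ α + |(m : ℝ)| ^ α))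
    (hu : hamiltonian Λ V u = (E₀ : ℂ) • (u : Ell2 Λ)) (M : ℕ) :
    stateNorm (extendZero (u : Ell2 Λ)) 1 ≤
        (2 * |C| + 1) * (1 + M : ℝ) ^ α * stateNorm (extendZero (u : Ell2 Λ)) (1 + M) ∧
      stateNorm (extendZero (u : Ell2 Λ)) (1 + M) ≤
        (2 * |C| + 1) * (1 + M : ℝ) ^ α * stateNorm (extendZero (u : Ell2 Λ)) 1 := by
  have hL : ∀ i ≤ M, ∀ j ≤ M, ‖transfer V E₀ (1 + i) (1 + j)‖ ≤
      (2 * |C| + 1) * (1 + M : ℝ) ^ α := fun i hi j hj => by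
    have hi' : (i : ℝ) ≤ M := by exact_mod_cast hi
    have hj' : (j : ℝ) ≤ M := by exact_mod_cast hj
    refine norm_transfer_le hα h (by simp) _ (mem_of_line hΛ (by omega)) _
      (mem_of_line hΛ (by omega)) ?_ ?_
    · push_cast
      rw [abs_of_nonneg (by positivity)]
      linarith
    · push_cast
      rw [abs_of_nonneg (by positivity)]
      linarith
  have heq : ∀ j : ℕ, j < M → extendZero (u : Ell2 Λ) (1 + j + 1 + 1) +
      extendZero (u : Ell2 Λ) (1 + j) + V (1 + j + 1) * extendZero (u : Ell2 Λ) (1 + j + 1) =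
        (E₀ : ℂ) * extendZero (u : Ell2 Λ) (1 + j + 1) := fun j _ => by
    have := eigenvector_equation hu (mem_of_line hΛ (n := 1 + j + 1) (by omega))
    rwa [add_sub_cancel_right] at this
  have h1 := stateNorm_left_le (δ := 0) hL (by simp) heq
  have h2 := stateNorm_right_le (δ := 0) hL (by simp) heq
  rw [mul_zero, add_zero, one_pow, mul_one] at h1 h2
  exact ⟨h1, h2⟩

theorem eigenvector_state_one_pos (hΛ : Λ = Set.univ ∨ Λ = Set.Ici 1) (hα : 0 ≤ α)
    (h : ∀ n ∈ Λ, ∀ m ∈ Λ, (n, m) ≠ (0, 0) →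
      ‖transfer V E₀ n m‖ ≤ C * (|(n : ℝ)| ^ α + |(m : ℝ)| ^ α))
    (hu : hamiltonian Λ V u = (E₀ : ℂ) • (u : Ell2 Λ)) (hu0 : u ≠ 0) :
    0 < stateNorm (extendZero (u : Ell2 Λ)) 1 := by
  refine (stateNorm_nonneg _ _).lt_of_ne' fun h0 => hu0 (Subtype.ext (lp.ext (funext fun n => ?_)))
  show (u : Ell2 Λ) n = 0
  rw [← extendZero_coe (u : Ell2 Λ) n, ← norm_le_zero_iff]
  refine (norm_le_stateNorm _ _).trans ?_
  rcases le_total 1 (n : ℤ) with hn | hn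
  · obtain ⟨M, hM⟩ : ∃ M : ℕ, (n : ℤ) = 1 + M := ⟨(n - 1 : ℤ).toNat, by omega⟩
    have := (eigenvector_state_one_le hΛ hα h hu M).2
    rwa [h0, mul_zero, ← hM] at this
  · rcases hΛ with rfl | rfl
    · obtain ⟨M, hM⟩ : ∃ M : ℕ, (n : ℤ) + M = 1 := ⟨(1 - n : ℤ).toNat, by omega⟩
      have hM' : (n : ℝ) + M = 1 := by exact_mod_cast hM
      have hL : ∀ i ≤ M, ∀ j ≤ M, ‖transfer V E₀ (n + i) (n + j)‖ ≤
          (2 * |C| + 1) * (1 + M : ℝ) ^ α := fun i hi j hj => by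
        have hi' : (i : ℝ) ≤ M := by exact_mod_cast hi
        have hj' : (j : ℝ) ≤ M := by exact_mod_cast hj
        have hi0 : (0 : ℝ) ≤ i := by positivity
        have hj0 : (0 : ℝ) ≤ j := by positivity
        refine norm_transfer_le hα h (by simp) _ trivial _ trivial ?_ ?_
        · push_cast
          rw [abs_le]
          constructor <;> linarith
        · push_cast
          rw [abs_le]
          constructor <;> linarith
      have := stateNorm_left_le (δ := 0) hL (φ := extendZero (u : Ell2 Set.univ)) (z := E₀)
        (by simp) fun j _ => by
          have := eigenvector_equation hu (Set.mem_univ (n + j + 1 : ℤ))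
          rwa [add_sub_cancel_right] at this
      rwa [hM, h0, mul_zero] at this
    · have hn1 : (n : ℤ) = 1 := le_antisymm hn n.2
      rw [hn1, h0]

/-- An eigenvector is square summable, while it decays at most like `n ^ (-α)`. -/
theorem half_lt_of_eigenvector (hΛ : Λ = Set.univ ∨ Λ = Set.Ici 1) (hα : 0 ≤ α)
    (h : ∀ n ∈ Λ, ∀ m ∈ Λ, (n, m) ≠ (0, 0) →
      ‖transfer V E₀ n m‖ ≤ C * (|(n : ℝ)| ^ α + |(m : ℝ)| ^ α))
    (hu : hamiltonian Λ V u = (E₀ : ℂ) • (u : Ell2 Λ)) (hu0 : u ≠ 0) : 1 / 2 < α := by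
  have hs := eigenvector_state_one_pos hΛ hα h hu hu0
  set s := stateNorm (extendZero (u : Ell2 Λ)) 1
  have hsum : Summable fun M : ℕ => stateNorm (extendZero (u : Ell2 Λ)) (1 + M) ^ 2 := by
    simp only [stateNorm_sq]
    have i1 : Function.Injective fun M : ℕ => (1 : ℤ) + M + 1 := fun a b h => by
      simp only at h; omega
    have i2 : Function.Injective fun M : ℕ => (1 : ℤ) + M := fun a b h => by
      simp only at h; omega
    exact ((hasSum_sq (u : Ell2 Λ)).summable.comp_injective i1).add
      ((hasSum_sq (u : Ell2 Λ)).summable.comp_injective i2)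
  have hC : 0 < 2 * |C| + 1 := by positivity
  have hcmp : Summable fun M : ℕ => ((M + 1 : ℕ) : ℝ) ^ (-(2 * α)) := by
    refine Summable.of_nonneg_of_le (fun M => by positivity) (fun M => ?_)
      (hsum.mul_left ((2 * |C| + 1) ^ 2 / s ^ 2))
    have hM : (0 : ℝ) < 1 + M := by positivity
    have h1 := pow_le_pow_left₀ hs.le (eigenvector_state_one_le hΛ hα h hu M).1 2
    have e : ((M + 1 : ℕ) : ℝ) ^ (-(2 * α)) = 1 / ((1 + M : ℝ) ^ α) ^ 2 := by
      push_cast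
      rw [add_comm (M : ℝ), Real.rpow_neg hM.le, mul_comm, Real.rpow_mul hM.le, Real.rpow_two,
        one_div]
    rw [e, div_mul_eq_mul_div, div_le_div_iff₀ (by positivity) (by positivity)]
    refine (le_of_eq (one_mul _)).trans (h1.trans (le_of_eq ?_))
    ring
  have := Real.summable_nat_rpow.1
    ((summable_nat_add_iff (f := fun M : ℕ => (M : ℝ) ^ (-(2 * α))) 1).1 hcmp)
  linarith

theorem eigenvector_one_ne_zero (hΛ : Λ = Set.Ici 1) (hα : 0 ≤ α)
    (h : ∀ n ∈ Λ, ∀ m ∈ Λ, (n, m) ≠ (0, 0) →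
      ‖transfer V E₀ n m‖ ≤ C * (|(n : ℝ)| ^ α + |(m : ℝ)| ^ α))
    (hu : hamiltonian Λ V u = (E₀ : ℂ) • (u : Ell2 Λ)) (hu0 : u ≠ 0) :
    extendZero (u : Ell2 Λ) 1 ≠ 0 := by
  intro h1
  have hs := eigenvector_state_one_pos (Or.inr hΛ) hα h hu hu0
  have g0 : extendZero (u : Ell2 Λ) 0 = 0 := extendZero_of_notMem _ (by simp [hΛ])
  have he := eigenvector_equation hu (one_mem_of_line (Or.inr hΛ))
  rw [sub_self, g0, h1, mul_zero, mul_zero, add_zero, add_zero] at he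
  have hsq := stateNorm_sq (extendZero (u : Ell2 Λ)) 1
  rw [he, h1, norm_zero] at hsq
  norm_num at hsq
  exact hs.ne' hsq

/-- Near an eigenvalue `|F|` is of order `T` at height `1 / T`, so that the estimate with `|F|²` is
better by a factor `T` than the one with the spectral measure. -/
theorem exists_le_moment_of_eigenvector (hΛ : Λ = Set.univ ∨ Λ = Set.Ici 1) (hα : 0 ≤ α)
    (h : ∀ n ∈ Λ, ∀ m ∈ Λ, (n, m) ≠ (0, 0) →
      ‖transfer V E₀ n m‖ ≤ C * (|(n : ℝ)| ^ α + |(m : ℝ)| ^ α))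
    (hu : hamiltonian Λ V u = (E₀ : ℂ) • (u : Ell2 Λ))
    (h1 : extendZero (u : Ell2 Λ) 1 ≠ 0) {p : ℝ} (hp : 0 ≤ p) : ∃ c : ℝ, 0 < c ∧
      ∀ᶠ T : ℝ in atTop, ENNReal.ofReal (c * T ^ ((p + 1 - 2 * α) / (1 + α))) ≤
        moment Λ V p T := by
  obtain ⟨c, hc, hc'⟩ := exists_le_outsideProb (V := V) hΛ |E₀| (2 * |C| + 1) α (by positivity) hα
  have hu1 : 0 < ‖extendZero (u : Ell2 Λ) 1‖ := norm_pos_iff.2 h1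
  have hun : 0 < ‖(u : Ell2 Λ)‖ := hu1.trans_le (norm_extendZero_le _ _)
  set κ : ℝ := ‖extendZero (u : Ell2 Λ) 1‖ ^ 2 / (2 * ‖(u : Ell2 Λ)‖ ^ 2) with hκ
  have hκ0 : 0 < κ := by positivity
  refine ⟨(2 ^ p)⁻¹ * (c * 2 * κ ^ 2), by positivity, ?_⟩
  filter_upwards [hc', eventually_gt_atTop 0, (tendsto_scale hα).eventually_ge_atTop 1]
    with T hT hT0 hN
  have hN0 : 0 < scale α T := by linarith
  have hF : ∀ E ∈ Set.Icc (E₀ - 1 / T) (E₀ + 1 / T), κ ^ 2 * T ^ 2 ≤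
      1 + ‖borelTransform Λ V ((E : ℂ) + ((1 / T : ℝ) : ℂ) * Complex.I)‖ ^ 2 := by
    intro E hE
    set z : ℂ := (E : ℂ) + ((1 / T : ℝ) : ℂ) * Complex.I with hz
    have him : z.im = 1 / T := by simp [hz]
    have hge := im_borelTransform_ge_of_eigenvector (one_mem_of_line hΛ) u hu (z := z)
      (by rw [him]; positivity)
    have hd : ‖(E₀ : ℂ) - z‖ ^ 2 ≤ 2 * (1 / T) ^ 2 := by
      have h2 : (E₀ - E) ^ 2 ≤ (1 / T) ^ 2 := sq_le_sq' (by linarith [hE.2]) (by linarith [hE.1])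
      have e : ‖(E₀ : ℂ) - z‖ ^ 2 = (E₀ - E) ^ 2 + (1 / T) ^ 2 := by
        rw [Complex.sq_norm, Complex.normSq_apply]
        simp [hz]
        ring
      rw [e]
      linarith
    rw [him] at hge
    set y := (borelTransform Λ V z).im
    have hy : 0 < y := by
      by_contra hneg
      have : ‖(E₀ : ℂ) - z‖ ^ 2 * ‖(u : Ell2 Λ)‖ ^ 2 * y ≤ 0 :=
        mul_nonpos_of_nonneg_of_nonpos (by positivity) (not_lt.1 hneg)
      have : 0 < 1 / T * ‖extendZero (u : Ell2 Λ) 1‖ ^ 2 := by positivity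
      linarith
    have hge2 : 1 / T * ‖extendZero (u : Ell2 Λ) 1‖ ^ 2 ≤
        2 * (1 / T) ^ 2 * ‖(u : Ell2 Λ)‖ ^ 2 * y := hge.trans (by gcongr)
    have hκy : κ * T ≤ y := by
      rw [hκ, div_mul_eq_mul_div, div_le_iff₀ (by positivity)]
      have := mul_le_mul_of_nonneg_left hge2 (sq_nonneg T)
      field_simp at this
      linarith
    have hn : y ≤ ‖borelTransform Λ V z‖ := (le_abs_self _).trans (Complex.abs_im_le_norm _)
    rw [← mul_pow]
    have := pow_le_pow_left₀ (by positivity) (hκy.trans hn) 2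
    linarith
  have hB : ENNReal.ofReal (2 * κ ^ 2 * T) ≤ ∫⁻ E in Set.Icc (E₀ - 1 / T) (E₀ + 1 / T),
      ENNReal.ofReal
        (1 + ‖borelTransform Λ V ((E : ℂ) + ((1 / T : ℝ) : ℂ) * Complex.I)‖ ^ 2) := by
    calc ENNReal.ofReal (2 * κ ^ 2 * T)
        = ∫⁻ E in Set.Icc (E₀ - 1 / T) (E₀ + 1 / T), ENNReal.ofReal (κ ^ 2 * T ^ 2) := by
          rw [setLIntegral_const, Real.volume_Icc, ← ENNReal.ofReal_mul (by positivity)]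
          congr 1
          field_simp
          ring
      _ ≤ _ := setLIntegral_mono' measurableSet_Icc fun E hE => ENNReal.ofReal_le_ofReal (hF E hE)
  have hout := hT {E₀} (by simpa using abs_le.1 le_rfl)
    (by
      rintro E rfl
      exact norm_transfer_le hα h hN) (Set.Icc (E₀ - 1 / T) (E₀ + 1 / T)) measurableSet_Icc
    fun E hE => ⟨E₀, rfl, by
        have h3 : 1 / T ≤ 3 / T := by gcongr; norm_num
        rw [abs_le]
        constructor <;> linarith [hE.1, hE.2]⟩
  refine le_trans ?_ (ofReal_mul_outsideProb_le_moment (R := scale α T / 2) hp (by positivity) hT0)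
  refine le_trans (le_of_eq ?_) (mul_le_mul_right ((mul_le_mul_right hB _).trans hout) _)
  rw [← ENNReal.ofReal_mul (by positivity), ← ENNReal.ofReal_mul (by positivity),
    ← scale_rpow hT0.le]
  congr 1
  have := half_rpow_mul_rpow (p := p) (s := 1 - 2 * α) hN0
  rw [← add_sub_assoc] at this
  rw [show (scale α T / 2) ^ p * (c / T * scale α T ^ (1 - 2 * α) * (2 * κ ^ 2 * T)) =
    (scale α T / 2) ^ p * scale α T ^ (1 - 2 * α) * (c * 2 * κ ^ 2) * (T / T) by ring, this,
    div_self hT0.ne']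
  ring

end

end Schrodinger

end

theorem theorem2p1 (Λ : Set ℤ) (hΛ : Λ = Set.univ ∨ Λ = Set.Ici 1) (V : ℤ → ℝ) :
    -- part (a)
    (∀ (K C α : ℝ) (A : ℝ → Set ℝ), 0 < K → 0 < C → 0 < α →
      (∀ᶠ N : ℝ in atTop, (A N).Nonempty ∧ MeasurableSet (A N) ∧ A N ⊆ Set.Icc (-K) K ∧
        ∀ E ∈ A N, ∀ n ∈ Λ, ∀ m ∈ Λ, |(n : ℝ)| ≤ N → |(m : ℝ)| ≤ N →
          ‖transfer V E n m‖ ≤ C * N ^ α) →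
      (∃ c : ℝ, 0 < c ∧ ∀ᶠ T : ℝ in atTop,
        ENNReal.ofReal (c / T * scale α T ^ (1 - 2 * α) *
          ∫ E in nbhd (A (scale α T)) (2 / T),
            (1 + (borelTransform Λ V ((E : ℂ) + ((1 / T : ℝ) : ℂ) * Complex.I)).im ^ 2)) ≤
          outsideProb Λ V (scale α T / 2) T) ∧
      (∃ c : ℝ, 0 < c ∧ ∀ᶠ T : ℝ in atTop,
        ENNReal.ofReal (c / T * scale α T ^ (1 - 2 * α) *
          (volume.real (nbhd (A (scale α T)) (1 / T)) +
            (spectralMeasure Λ V).real (nbhd (A (scale α T)) (1 / T)))) ≤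
          outsideProb Λ V (scale α T / 2) T) ∧
      ∀ p : ℝ, 0 < p → ∃ c : ℝ, 0 < c ∧ ∀ᶠ T : ℝ in atTop,
        ENNReal.ofReal (c / T * scale α T ^ (p + 1 - 2 * α) *
          (volume.real (nbhd (A (scale α T)) (1 / T)) +
            (spectralMeasure Λ V).real (nbhd (A (scale α T)) (1 / T)))) ≤
          moment Λ V p T) ∧
    -- part (b)
    (∀ (K C α : ℝ) (A : Set ℝ), 0 < K → 0 ≤ α → MeasurableSet A → A ⊆ Set.Icc (-K) K →
      0 < spectralMeasure Λ V A →
      (∀ E ∈ A, ∀ n ∈ Λ, ∀ m ∈ Λ, (n, m) ≠ (0, 0) →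
        ‖transfer V E n m‖ ≤ C * (|(n : ℝ)| ^ α + |(m : ℝ)| ^ α)) →
      ∀ p : ℝ, 0 < p → (((p - 3 * α) / (1 + α) : ℝ) : EReal) ≤ lowerExponent Λ V p) ∧
    -- part (c)
    (∀ E₀ C α : ℝ, 0 ≤ α →
      (∀ n ∈ Λ, ∀ m ∈ Λ, (n, m) ≠ (0, 0) →
        ‖transfer V E₀ n m‖ ≤ C * (|(n : ℝ)| ^ α + |(m : ℝ)| ^ α)) →
      (∀ p : ℝ, 0 < p → ∃ c : ℝ, 0 < c ∧ ∀ᶠ T : ℝ in atTop,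
        ENNReal.ofReal (c * T ^ ((p - 3 * α) / (1 + α)) *
          (T⁻¹ + (spectralMeasure Λ V).real (Set.Icc (E₀ - T⁻¹) (E₀ + T⁻¹)))) ≤
          moment Λ V p T) ∧
      ∀ u : (hamiltonian Λ V).domain, u ≠ 0 → hamiltonian Λ V u = (E₀ : ℂ) • (u : Ell2 Λ) →
        1 / 2 < α ∧ (Λ = Set.Ici 1 → extendZero (u : Ell2 Λ) 1 ≠ 0) ∧
        (extendZero (u : Ell2 Λ) 1 ≠ 0 →
          ∀ p : ℝ, 0 < p →
            (((p + 1 - 2 * α) / (1 + α) : ℝ) : EReal) ≤ lowerExponent Λ V p)) := by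
  refine ⟨fun K C α A _ hC hα hA => ⟨?_, ?_, fun p hp => ?_⟩,
    fun K C α A _ hα hAm hA hμ hbd p hp => ?_,
    fun E₀ C α hα hbd => ⟨fun p hp => ?_, fun u hu0 hu =>
      ⟨half_lt_of_eigenvector hΛ hα hbd hu hu0,
        fun hΛ' => eigenvector_one_ne_zero hΛ' hα hbd hu hu0, fun h1 p hp => ?_⟩⟩⟩
  · obtain ⟨c, hc, h⟩ := exists_le_outsideProb (V := V) hΛ K C α hC hα.le
    refine ⟨c, hc, ?_⟩
    filter_upwards [h, eventually_gt_atTop 0, (tendsto_scale hα.le).eventually hA] with T h hT hAT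
    have hN : 0 ≤ scale α T := Real.rpow_nonneg hT.le _
    rw [ENNReal.ofReal_mul (by positivity)]
    refine le_trans (mul_le_mul_right ?_ _)
      (h _ hAT.2.2.1 hAT.2.2.2 _ Metric.isClosed_cthickening.measurableSet
        fun E hE => exists_of_mem_cthickening hT hE)
    refine (ofReal_integral_le_lintegral fun E => by positivity).trans
      ((lintegral_mono_set (nbhd_subset_cthickening _ _)).trans
        (lintegral_mono fun E => ENNReal.ofReal_le_ofReal ?_))
    gcongr 1 + ?_
    rw [← sq_abs]
    exact pow_le_pow_left₀ (abs_nonneg _) (Complex.abs_im_le_norm _) 2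
  · obtain ⟨c, hc, h⟩ := exists_le_outsideProb_measure (V := V) hΛ K C α hC hα.le
    refine ⟨c, hc, ?_⟩
    filter_upwards [h, (tendsto_scale hα.le).eventually hA] with T h hAT
    exact h _ hAT.2.2.1 hAT.2.2.2
  · obtain ⟨c, hc, h⟩ := exists_le_moment_measure (V := V) hΛ K C α hC hα.le hp.le
    refine ⟨c, hc, ?_⟩
    filter_upwards [h, (tendsto_scale hα.le).eventually hA] with T h hAT
    exact h _ hAT.2.2.1 hAT.2.2.2
  · obtain ⟨c, hc, h⟩ := exists_le_moment_measure (V := V) hΛ K (2 * |C| + 1) α (by positivity)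
      hα hp.le
    have hfin := (spectralMeasure_spec Λ V).1
    have hμA : 0 < (spectralMeasure Λ V).real A := ENNReal.toReal_pos hμ.ne' (measure_ne_top _ _)
    refine le_lowerExponent_of_eventually_le (mul_pos hc hμA) ?_
    filter_upwards [h, eventually_gt_atTop 0, (tendsto_scale hα).eventually_ge_atTop 1]
      with T h hT hN
    refine le_trans (ENNReal.ofReal_le_ofReal ?_)
      (h A hA fun E hE => norm_transfer_le hα (hbd E hE) hN)
    have hsub : (spectralMeasure Λ V).real A ≤ (spectralMeasure Λ V).real (nbhd A (1 / T)) :=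
      measureReal_mono fun E hE => ⟨E, hE, by rw [sub_self, abs_zero]; positivity⟩
    rw [← inv_mul_scale_rpow hα hT]
    calc c * (spectralMeasure Λ V).real A * (T⁻¹ * scale α T ^ (p + 1 - 2 * α))
        = c / T * scale α T ^ (p + 1 - 2 * α) * (0 + (spectralMeasure Λ V).real A) := by ring
      _ ≤ _ := by
        gcongr
        exact measureReal_nonneg
  · obtain ⟨c, hc, h⟩ := exists_le_moment_measure (V := V) hΛ |E₀| (2 * |C| + 1) α (by positivity)
      hα hp.le
    refine ⟨c, hc, ?_⟩
    filter_upwards [h, eventually_gt_atTop 0, (tendsto_scale hα).eventually_ge_atTop 1]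
      with T h hT hN
    refine le_trans (ENNReal.ofReal_le_ofReal ?_) (h {E₀} (by simpa using abs_le.1 le_rfl) (by
      rintro E rfl
      exact norm_transfer_le hα hbd hN))
    have hvol : volume.real (Set.Icc (E₀ - T⁻¹) (E₀ + T⁻¹)) = 2 * T⁻¹ := by
      rw [Real.volume_real_Icc_of_le (by linarith [inv_pos.2 hT])]
      ring
    rw [← inv_mul_scale_rpow hα hT, nbhd_singleton, one_div, hvol]
    calc c * (T⁻¹ * scale α T ^ (p + 1 - 2 * α)) *
          (T⁻¹ + (spectralMeasure Λ V).real (Set.Icc (E₀ - T⁻¹) (E₀ + T⁻¹)))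
        = c / T * scale α T ^ (p + 1 - 2 * α) *
          (T⁻¹ + (spectralMeasure Λ V).real (Set.Icc (E₀ - T⁻¹) (E₀ + T⁻¹))) := by ring
      _ ≤ _ := by
        gcongr
        linarith [inv_pos.2 hT]
  · obtain ⟨c, hc, h⟩ := exists_le_moment_of_eigenvector hΛ hα hbd hu h1 hp.le
    exact le_lowerExponent_of_eventually_le hc h
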